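/- Composition is written in diagrammatic order. A \emph{C0-system} is a category $CC$ with functions $l:Ob\to\mathbf N$, $ft:Ob\to Ob$, a final object $pt$ which is the only object of length $0$, with $ft(pt)=pt$ and $l(ft(X))=l(X)-1$ if $l(X)>0$, morphisms $p_X:X\to ft(X)$, and, for $l(X)>0$ and $f:\Gamma'\to ft(X)$, an object $f^*(X)$ with $l(f^*(X))>0$, $ft(f^*(X))=\Gamma'$ and a morphism $q(f,X):f^*(X)\to X$ with $q(f,X)\circ p_X=p_{f^*(X)}\circ f$, such that $Id^*(X)=X$, $q(Id,X)=Id_X$, $(g\circ f)^*(X)=g^*(f^*(X))$, $q(g\circ f,X)=q(g,f^*(X))\circ q(f,X)$. A \emph{C-system} is a C0-system with an operation assigning to $a:X\to Y$ with $l(Y)>0$ a section $s_a:X\to (a\circ p_Y)^*(Y)$ of $p_{(a\circ p_Y)^*(Y)}$ with $s_a\circ q(a\circ p_Y,Y)=a$, and $s_a=s_{a\circ q(b,Z)}$ whenever $Y=b^*(Z)$ with $l(Z)>0$, $b:ft(Y)\to ft(Z)$ (equivalently, the canonical squares are pullbacks). Write $X\ge\Gamma$ if $l(X)\ge l(\Gamma)$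 and $ft^{\,l(X)-l(\Gamma)}(X)=\Gamma$, and $X>\Gamma$ if moreover $l(X)>l(\Gamma)$; then $p(X,\Gamma):X\to\Gamma$ is the composite of the $p$'s, and for $f:\Gamma'\to\Gamma$ the object $f^*(X)$ and $q(f,X):f^*(X)\to X$ are defined by $f^*(\Gamma)=\Gamma'$, $q(f,\Gamma)=f$, $f^*(X)=q(f,ft(X))^*(X)$, $q(f,X)=q(q(f,ft(X)),X)$. A morphism $a:X\to Y$ is over $\Gamma$ if $X,Y\ge\Gamma$ and $a\circ p(Y,\Gamma)=p(X,\Gamma)$; then $f^*(a):f^*(X)\to f^*(Y)$ is the unique morphism over $\Gamma'$ with $f^*(a)\circ q(f,Y)=q(f,X)\circ a$. For $X,Y\ge \Gamma$ put $X\times_\Gamma Y=p(X,\Gamma)^*(Y)$, and let $exch(X,Y;\Gamma):X\times_\Gamma Y\to Y\times_\Gamma X$ be the canonical exchange isomorphism. Let $\mathcal{O}b_n(\Gamma)=\{X: l(X)=l(\Gamma)+n,\ ft^n(X)=\Gamma\}$ and let $\widetilde{\mathcal{O}b}_n(\Gamma)$ be the set of sections $o$ of $p_X$, where $X=codom(o)\in\mathcal{O}b_n(\Gamma)$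 and $X>\Gamma$; with $f^*$ these are presheaves on $CC$, and $\partial(o)=codom(o)$ is a morphism $\widetilde{\mathcal{O}b}_n\to\mathcal{O}b_n$. For an object $X$ with $l(X)>0$, $\partial^{-1}(X)$ also denotes the set of sections of $p_X$ (and it is empty for $X=pt$). For $B$ with $l(B)\ge2$ put $A=ft(B)$, $\Gamma=ft^2(B)$. A \emph{Cartmell–Streicher structure} on $CC$ is a pair $(\underline\Pi,Ap)$ where (1) $\underline\Pi:Ob_{\ge2}\to Ob$ satisfies $ft(\underline\Pi(B))=\Gamma$ and $f^*(\underline\Pi(B))=\underline\Pi(f^*(B))$ for all $f:\Gamma'\to\Gamma$; (2) $Ap$ is a family of morphisms $Ap_B:A\times_\Gamma\underline\Pi(B)\to B$, $B\in Ob_{\ge2}$, over $A$, with $f^*(Ap_B)=Ap_{f^*(B)}$ for all $f:\Gamma'\to\Gamma$, and such that $\lambda inv_B:\partial^{-1}(\underline\Pi(B))\to\partial^{-1}(B)$, $s\mapsto p_A^*(s)\circ Ap_B$, is bijective. A \emph{$(\Pi,\lambda)$-structure} is a pair of morphisms of presheaves $\Pi:\mathcal{O}b_2\to\mathcal{O}b_1$,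 $\lambda:\widetilde{\mathcal{O}b}_2\to\widetilde{\mathcal{O}b}_1$ such that the square formed by $\lambda$, $\partial$, $\partial$, $\Pi$ (with $\lambda\circ\partial=\partial\circ\Pi$) is a pullback. For $\underline\Pi$ as in (1) let $AllAp_1^{\underline\Pi}$ be the set of families as in (2), and $AllAp_2^{\underline\Pi}$ the set of families $Ap_B:\underline\Pi(B)\times_\Gamma A\to B$, $B\in Ob_{\ge 2}$, with $Ap_B\circ p_B=q(p_{\underline\Pi(B)},A)$, $f^*(Ap_B)=Ap_{f^*(B)}$ for all $f:\Gamma'\to\Gamma$, and $\lambda inv_B:\partial^{-1}(\underline\Pi(B))\to\partial^{-1}(B)$, $s\mapsto q(s,\underline\Pi(B)\times_\Gamma A)\circ Ap_B$, bijective. For $\Pi:\mathcal{O}b_2\to\mathcal{O}b_1$ let $All\lambda_1^\Pi$ be the set of $\lambda$ forming a $(\Pi,\lambda)$-structure with $\Pi$, and $All\lambda_2^\Pi$ the set of double families of bijections $\lambda_{\Gamma,B}:\partial^{-1}(B)\to\partial^{-1}(\Pi_\Gamma(B))$ ($\Gamma\in Ob$, $B\in\mathcal{O}b_2(\Gamma)$)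 with $f^*\lambda_{\Gamma,B}(o)=\lambda_{\Gamma',f^*(B)}(f^*(o))$ for all $f:\Gamma'\to\Gamma$. \textbf{Theorem.} Let $CC$ be a C-system. (i) $\Phi(\Pi)(B)=\Pi_{ft^2(B)}(B)$ defines a bijection $\Phi$ from the set of morphisms $\mathcal{O}b_2\to\mathcal{O}b_1$ to the set of functions $\underline\Pi$ as in (1). (ii) For every $\Pi:\mathcal{O}b_2\to\mathcal{O}b_1$ there is a bijection $e_1:All\lambda_1^\Pi\to All\lambda_2^\Pi$ given by $e_1(\lambda)_{\Gamma,B}(o)=\lambda_\Gamma(o)$. (iii) For every $\Pi$ there is a bijection $e_2:All\lambda_2^\Pi\to AllAp_2^{\Phi(\Pi)}$ given, with $\underline\Pi=\Phi(\Pi)$, by $e_2(\lambda)_B=ap_B\circ q(p_{\underline\Pi(B)},B)$, where $ap_B\in\partial^{-1}(\underline\Pi(B)\times_\Gamma B)$ is such that $\lambda_{\underline\Pi(B),\,\underline\Pi(B)\times_\Gamma B}(ap_B)=s_{Id_{\underline\Pi(B)}}$; its inverse is given by $e_2^{-1}(Ap)_{\Gamma,B}=(\lambda inv_B)^{-1}$.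 (iv) For every $\underline\Pi$ as in (1) there is a bijection $e_3:AllAp_2^{\underline\Pi}\to AllAp_1^{\underline\Pi}$ given by $e_3(Ap)_B=exch(A,\underline\Pi(B);\Gamma)\circ Ap_B$. (v) Consequently $(\Pi,\lambda)\mapsto(\Phi(\Pi),e_3(e_2(e_1(\lambda))))$ is a bijection from the set of $(\Pi,\lambda)$-structures on $CC$ to the set of Cartmell–Streicher structures on $CC$. -/

import Mathlib

open CategoryTheory

universe v u

/-- A C0-system: a category with a length function, a father function `ft`, a final object `pt` of
length `0`, projections `p X : X ⟶ ft X`, and canonical squares. In `p`, `pb` and `q` the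
codomain `ft X` is written as any `Γ` with `ft X = Γ`, so that composites need no casts. Here
`pb f X = f^*(X)` and `q f X = q(f, X) : f^*(X) ⟶ X` for `l X > 0` and `f : Γ' ⟶ ft X`. -/
class C0System (C : Type u) extends Category.{v} C where
  l : C → ℕ
  ft : C → C
  pt : C
  l_eq_zero_iff : ∀ X : C, l X = 0 ↔ X = pt
  l_ft : ∀ X : C, 0 < l X → l (ft X) = l X - 1
  ft_pt : ft pt = pt
  pt_final : ∀ X : C, Nonempty (Unique (X ⟶ pt))
  p : ∀ (X : C) {Γ : C}, ft X = Γ → (X ⟶ Γ)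
  pb : ∀ {Γ' Γ : C} (_ : Γ' ⟶ Γ) (X : C), ft X = Γ → 0 < l X → C
  q : ∀ {Γ' Γ : C} (f : Γ' ⟶ Γ) (X : C) (h : ft X = Γ) (hX : 0 < l X), pb f X h hX ⟶ X
  l_pb_pos : ∀ {Γ' Γ : C} (f : Γ' ⟶ Γ) (X : C) (h : ft X = Γ) (hX : 0 < l X),
    0 < l (pb f X h hX)
  ft_pb : ∀ {Γ' Γ : C} (f : Γ' ⟶ Γ) (X : C) (h : ft X = Γ) (hX : 0 < l X),
    ft (pb f X h hX) = Γ'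
  q_comp_p : ∀ {Γ' Γ : C} (f : Γ' ⟶ Γ) (X : C) (h : ft X = Γ) (hX : 0 < l X),
    q f X h hX ≫ p X h = p (pb f X h hX) (ft_pb f X h hX) ≫ f
  pb_id : ∀ {Γ : C} (X : C) (h : ft X = Γ) (hX : 0 < l X), pb (𝟙 Γ) X h hX = X
  q_id : ∀ {Γ : C} (X : C) (h : ft X = Γ) (hX : 0 < l X),
    q (𝟙 Γ) X h hX = eqToHom (pb_id X h hX)
  pb_comp : ∀ {Γ'' Γ' Γ : C} (g : Γ'' ⟶ Γ') (f : Γ' ⟶ Γ) (X : C) (h : ft X = Γ) (hX : 0 < l X),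
    pb (g ≫ f) X h hX = pb g (pb f X h hX) (ft_pb f X h hX) (l_pb_pos f X h hX)
  q_comp : ∀ {Γ'' Γ' Γ : C} (g : Γ'' ⟶ Γ') (f : Γ' ⟶ Γ) (X : C) (h : ft X = Γ) (hX : 0 < l X),
    q (g ≫ f) X h hX = eqToHom (pb_comp g f X h hX) ≫
      q g (pb f X h hX) (ft_pb f X h hX) (l_pb_pos f X h hX) ≫ q f X h hX

/-- A C-system: a C0-system with an operation `a ↦ s_a`, defined for `a : X ⟶ Y` with `l Y > 0`,
where `ft a = a ≫ p Y`. Equality of `Arrow`s is equality in the set of all morphisms. -/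
class CSystem (C : Type u) extends C0System.{v} C where
  s : ∀ {X Y : C} (a : X ⟶ Y) (hY : 0 < l Y), X ⟶ pb (a ≫ p Y rfl) Y rfl hY
  s_p : ∀ {X Y : C} (a : X ⟶ Y) (hY : 0 < l Y), s a hY ≫ p _ (ft_pb _ _ _ _) = 𝟙 X
  s_q : ∀ {X Y : C} (a : X ⟶ Y) (hY : 0 < l Y), s a hY ≫ q (a ≫ p Y rfl) Y rfl hY = a
  s_comp_q : ∀ {X Γ' Γ : C} (b : Γ' ⟶ Γ) (Z : C) (h : ft Z = Γ) (hZ : 0 < l Z)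
    (a : X ⟶ pb b Z h hZ),
    Arrow.mk (s a (l_pb_pos b Z h hZ)) = Arrow.mk (s (a ≫ q b Z h hZ) hZ)

namespace CSystem

open C0System

variable {C : Type u} [CSystem.{v} C]

theorem eqToHom_p {X Y Γ : C} (e : X = Y) (h : ft Y = Γ) :
    eqToHom e ≫ p Y h = p X ((congrArg ft e).trans h) := by
  subst e; simp

/-- The canonical squares of a C-system are pullbacks. -/
theorem isPullback_pb {Γ' Γ : C} (f : Γ' ⟶ Γ) (X : C) (h : ft X = Γ) (hX : 0 < l X) :
    IsPullback (q f X h hX) (p (pb f X h hX) (ft_pb f X h hX)) (p X h) f := by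
  have uniq : ∀ {Z : C} (u u' : Z ⟶ pb f X h hX), u ≫ q f X h hX = u' ≫ q f X h hX →
      u ≫ p _ (ft_pb f X h hX) = u' ≫ p _ (ft_pb f X h hX) → u = u' := by
    intro Z u u' h1 h2
    have h3 : u ≫ p (pb f X h hX) rfl = u' ≫ p (pb f X h hX) rfl := by
      have : ∀ {Δ : C} (e : ft (pb f X h hX) = Δ), u ≫ p _ e = u' ≫ p _ e →
          u ≫ p (pb f X h hX) rfl = u' ≫ p (pb f X h hX) rfl := by
        intro Δ e; subst e; exact id
      exact this _ h2
    have hs : Arrow.mk (s u (l_pb_pos f X h hX)) = Arrow.mk (s u' (l_pb_pos f X h hX)) := by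
      rw [s_comp_q, s_comp_q, h1]
    rw [← s_q u (l_pb_pos f X h hX), ← s_q u' (l_pb_pos f X h hX)]
    revert hs
    generalize s u (l_pb_pos f X h hX) = a
    generalize s u' (l_pb_pos f X h hX) = b
    revert a b
    rw [h3]
    intro a b hs
    rw [Arrow.mk_inj] at hs
    rw [hs]
  have ex : ∀ {Z : C} (a : Z ⟶ X) (b : Z ⟶ Γ'), a ≫ p X h = b ≫ f →
      ∃ u : Z ⟶ pb f X h hX, u ≫ q f X h hX = a ∧ u ≫ p _ (ft_pb f X h hX) = b := by
    intro Z a b hab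
    have aux : ∀ g : Z ⟶ Γ, a ≫ p X h = g → ∃ t : Z ⟶ pb g X h hX,
        t ≫ p _ (ft_pb g X h hX) = 𝟙 Z ∧ t ≫ q g X h hX = a := by
      intro g hg
      subst hg
      subst h
      exact ⟨s a hX, s_p a hX, s_q a hX⟩
    obtain ⟨t, ht1, ht2⟩ := aux _ hab
    refine ⟨t ≫ eqToHom (pb_comp b f X h hX) ≫
      q b (pb f X h hX) (ft_pb f X h hX) (l_pb_pos f X h hX), ?_, ?_⟩
    · rw [← ht2, q_comp b f]; simp
    · rw [Category.assoc, Category.assoc, q_comp_p, ← Category.assoc (eqToHom _), eqToHom_p,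
        ← Category.assoc, ht1, Category.id_comp]
  refine ⟨⟨q_comp_p f X h hX⟩, ⟨Limits.PullbackCone.IsLimit.mk _
    (fun c => (ex c.fst c.snd c.condition).choose)
    (fun c => (ex c.fst c.snd c.condition).choose_spec.1)
    (fun c => (ex c.fst c.snd c.condition).choose_spec.2) ?_⟩⟩
  intro c m h1 h2
  have h3 := (ex c.fst c.snd c.condition).choose_spec
  exact uniq _ _ (h1.trans h3.1.symm) (h2.trans h3.2.symm)

theorem iter_ft_succ {X Γ : C} {n : ℕ} (hl : l X = l Γ + (n + 1)) (h : ft^[n + 1] X = Γ) :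
    l (ft X) = l Γ + n ∧ ft^[n] (ft X) = Γ ∧ 0 < l X :=
  ⟨by rw [l_ft X (by omega)]; omega, h, by omega⟩

/-- The pair of `f^*(X)` and `q(f, X)` for `X` of relative length `n` over `Γ`, by recursion. -/
def pullAux {Γ' Γ : C} (f : Γ' ⟶ Γ) : (n : ℕ) → (X : C) → l X = l Γ + n → ft^[n] X = Γ →
    Σ Y : C, Y ⟶ X
  | 0, _, _, h => ⟨Γ', f ≫ eqToHom h.symm⟩
  | n + 1, X, hl, h =>
    ⟨pb (pullAux f n (ft X) (iter_ft_succ hl h).1 (iter_ft_succ hl h).2.1).2 X rfl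
        (iter_ft_succ hl h).2.2,
      q (pullAux f n (ft X) (iter_ft_succ hl h).1 (iter_ft_succ hl h).2.1).2 X rfl
        (iter_ft_succ hl h).2.2⟩

/-- The composite of `n` projections `X ⟶ Γ`. -/
def pAux {Γ : C} : (n : ℕ) → (X : C) → ft^[n] X = Γ → (X ⟶ Γ)
  | 0, _, h => eqToHom h
  | n + 1, X, h => p X rfl ≫ pAux n (ft X) h

theorem l_pullAux {Γ' Γ : C} (f : Γ' ⟶ Γ) : ∀ (n : ℕ) (X : C) (hl : l X = l Γ + n)
    (h : ft^[n] X = Γ), l (pullAux f n X hl h).1 = l Γ' + n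
  | 0, _, _, _ => rfl
  | n + 1, X, hl, h => by
    have e := l_pullAux f n (ft X) (iter_ft_succ hl h).1 (iter_ft_succ hl h).2.1
    have e1 := l_pb_pos (pullAux f n (ft X) (iter_ft_succ hl h).1 (iter_ft_succ hl h).2.1).2 X rfl
        (iter_ft_succ hl h).2.2
    have e2 := l_ft _ e1
    rw [ft_pb, e] at e2
    change l (pb _ _ _ _) = _
    omega

theorem ft_pullAux {Γ' Γ : C} (f : Γ' ⟶ Γ) : ∀ (n : ℕ) (X : C) (hl : l X = l Γ + n)
    (h : ft^[n] X = Γ), ft^[n] (pullAux f n X hl h).1 = Γ'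
  | 0, _, _, _ => rfl
  | n + 1, X, hl, h => by
    change ft^[n] (ft (pb _ _ _ _)) = _
    rw [ft_pb]
    exact ft_pullAux f n (ft X) _ _

theorem pAux_of_ft {Γ X Δ : C} {n : ℕ} (e : ft X = Δ) (h : ft^[n + 1] X = Γ) :
    pAux (n + 1) X h = p X e ≫ pAux n Δ (by subst e; exact h) := by
  subst e; rfl

theorem isPullback_pullAux {Γ' Γ : C} (f : Γ' ⟶ Γ) : ∀ (n : ℕ) (X : C) (hl : l X = l Γ + n)
    (h : ft^[n] X = Γ), IsPullback (pullAux f n X hl h).2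
      (pAux n (pullAux f n X hl h).1 (ft_pullAux f n X hl h)) (pAux n X h) f
  | 0, X, hl, h => by
    have h' : X = Γ := h
    subst h'
    have : IsPullback (f ≫ 𝟙 X) (𝟙 Γ') (𝟙 X) f := IsPullback.of_vert_isIso ⟨by simp⟩
    exact this
  | n + 1, X, hl, h => by
    have e := isPullback_pullAux f n (ft X) (iter_ft_succ hl h).1 (iter_ft_succ hl h).2.1
    have := (isPullback_pb (pullAux f n (ft X) (iter_ft_succ hl h).1
      (iter_ft_succ hl h).2.1).2 X rfl (iter_ft_succ hl h).2.2).paste_vert e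
    rw [pAux_of_ft (X := (pullAux f (n + 1) X hl h).1) (ft_pb (pullAux f n (ft X)
      (iter_ft_succ hl h).1 (iter_ft_succ hl h).2.1).2 X rfl (iter_ft_succ hl h).2.2)]
    exact this

/-- Any pair `(f^*(X), q(f, X))` computed from equal data is the same. -/
theorem pullPair_congr {X Δ : C} (h : ft X = Δ) (hX : 0 < l X) {r r' : Σ Y : C, Y ⟶ Δ}
    (e : r = r') : (⟨pb r.2 X h hX, q r.2 X h hX⟩ : Σ Y : C, Y ⟶ X) =
      ⟨pb r'.2 X h hX, q r'.2 X h hX⟩ := by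
  subst e; rfl

theorem pullAux_id {Γ : C} : ∀ (n : ℕ) (X : C) (hl : l X = l Γ + n)
    (h : ft^[n] X = Γ), pullAux (𝟙 Γ) n X hl h = ⟨X, 𝟙 X⟩
  | 0, X, hl, h => by
    have h' : X = Γ := h
    subst h'
    simp [pullAux]
  | n + 1, X, hl, h => by
    refine (pullPair_congr rfl (iter_ft_succ hl h).2.2
      (pullAux_id n (ft X) (iter_ft_succ hl h).1 (iter_ft_succ hl h).2.1)).trans ?_
    rw [Sigma.mk.injEq]
    refine ⟨pb_id _ _ _, ?_⟩
    rw [q_id]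
    exact (eqToHom_heq_id_cod _ _ _)

theorem pullAux_of_ft {Γ' Γ X Δ : C} (g : Γ' ⟶ Γ) {n : ℕ} (e : ft X = Δ)
    (hl : l X = l Γ + (n + 1)) (h : ft^[n + 1] X = Γ) (hl' : l Δ = l Γ + n) (h' : ft^[n] Δ = Γ) :
    pullAux g (n + 1) X hl h = ⟨pb (pullAux g n Δ hl' h').2 X e (iter_ft_succ hl h).2.2,
      q (pullAux g n Δ hl' h').2 X e (iter_ft_succ hl h).2.2⟩ := by
  subst e; rfl

theorem pullAux_comp {Γ'' Γ' Γ : C} (g : Γ'' ⟶ Γ') (f : Γ' ⟶ Γ) : ∀ (n : ℕ) (X : C)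
    (hl : l X = l Γ + n) (h : ft^[n] X = Γ), pullAux (g ≫ f) n X hl h =
      ⟨(pullAux g n (pullAux f n X hl h).1 (l_pullAux f n X hl h) (ft_pullAux f n X hl h)).1,
        (pullAux g n (pullAux f n X hl h).1 (l_pullAux f n X hl h) (ft_pullAux f n X hl h)).2 ≫
          (pullAux f n X hl h).2⟩
  | 0, X, hl, h => by
    have h' : X = Γ := h
    subst h'
    change (⟨Γ'', (g ≫ f) ≫ 𝟙 X⟩ : Σ Y : C, Y ⟶ X) = ⟨Γ'', (g ≫ 𝟙 Γ') ≫ (f ≫ 𝟙 X)⟩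
    simp
  | n + 1, X, hl, h => by
    refine (pullPair_congr rfl (iter_ft_succ hl h).2.2
      (pullAux_comp g f n (ft X) (iter_ft_succ hl h).1 (iter_ft_succ hl h).2.1)).trans ?_
    rw [pullAux_of_ft (X := (pullAux f (n + 1) X hl h).1) g (ft_pb (pullAux f n (ft X) (iter_ft_succ hl h).1
      (iter_ft_succ hl h).2.1).2 X rfl (iter_ft_succ hl h).2.2) _ _ (l_pullAux f n (ft X) _ _)
      (ft_pullAux f n (ft X) _ _)]
    dsimp only
    rw [Sigma.mk.injEq]
    refine ⟨pb_comp _ _ _ _ _, ?_⟩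
    rw [q_comp]
    exact eqToHom_comp_heq _ _

/-- `X ≥ Γ`: the object `X` is over `Γ`. -/
def ObOver (X Γ : C) : Prop := l Γ ≤ l X ∧ ft^[l X - l Γ] X = Γ

theorem ObOver.l_eq {X Γ : C} (h : ObOver X Γ) : l X = l Γ + (l X - l Γ) := by
  have := h.1
  omega

/-- `p(X, Γ) : X ⟶ Γ` for `X ≥ Γ`. -/
def pTo {X Γ : C} (h : ObOver X Γ) : X ⟶ Γ := pAux (l X - l Γ) X h.2

/-- `f^*(X)` for `X ≥ Γ` and `f : Γ' ⟶ Γ`. -/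
def pull {Γ' Γ : C} (f : Γ' ⟶ Γ) {X : C} (h : ObOver X Γ) : C :=
  (pullAux f (l X - l Γ) X h.l_eq h.2).1

/-- `q(f, X) : f^*(X) ⟶ X` for `X ≥ Γ` and `f : Γ' ⟶ Γ`. -/
def qTo {Γ' Γ : C} (f : Γ' ⟶ Γ) {X : C} (h : ObOver X Γ) : pull f h ⟶ X :=
  (pullAux f (l X - l Γ) X h.l_eq h.2).2

/-- `a : X ⟶ Y` is a morphism over `Γ`. -/
def IsOver {X Y Γ : C} (hX : ObOver X Γ) (hY : ObOver Y Γ) (a : X ⟶ Y) : Prop :=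
  a ≫ pTo hY = pTo hX

theorem over_of_iter {X Γ : C} {n : ℕ} (hl : l X = l Γ + n) (h : ft^[n] X = Γ) : ObOver X Γ := by
  obtain rfl : n = l X - l Γ := by omega
  exact ⟨by omega, h⟩

theorem pTo_eq {X Γ : C} (h : ObOver X Γ) {n : ℕ} (hl : l X = l Γ + n) (hf : ft^[n] X = Γ) :
    pTo h = pAux n X hf := by
  obtain rfl : n = l X - l Γ := by omega
  rfl

theorem pull_eq {Γ' Γ : C} (f : Γ' ⟶ Γ) {X : C} (h : ObOver X Γ) {n : ℕ} (hl : l X = l Γ + n)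
    (hf : ft^[n] X = Γ) :
    (⟨pull f h, qTo f h⟩ : Σ Y : C, Y ⟶ X) = pullAux f n X hl hf := by
  obtain rfl : n = l X - l Γ := by omega
  rfl

theorem l_pull {Γ' Γ : C} (f : Γ' ⟶ Γ) {X : C} (h : ObOver X Γ) :
    l (pull f h) = l Γ' + (l X - l Γ) := l_pullAux f _ X h.l_eq h.2

theorem ft_iter_pull {Γ' Γ : C} (f : Γ' ⟶ Γ) {X : C} (h : ObOver X Γ) :
    ft^[l X - l Γ] (pull f h) = Γ' := ft_pullAux f _ X h.l_eq h.2

theorem over_pull {Γ' Γ : C} (f : Γ' ⟶ Γ) {X : C} (h : ObOver X Γ) : ObOver (pull f h) Γ' :=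
  over_of_iter (l_pull f h) (ft_iter_pull f h)

theorem isPullback_pull {Γ' Γ : C} (f : Γ' ⟶ Γ) {X : C} (h : ObOver X Γ) :
    IsPullback (qTo f h) (pTo (over_pull f h)) (pTo h) f := by
  rw [pTo_eq (over_pull f h) (l_pull f h) (ft_iter_pull f h)]
  exact isPullback_pullAux f _ X h.l_eq h.2

theorem pull_id {X Γ : C} (h : ObOver X Γ) : pull (𝟙 Γ) h = X :=
  congrArg Sigma.fst (pullAux_id _ X h.l_eq h.2)

theorem eq_eqToHom_of_sigma {X Y Z : C} {a : Y ⟶ X} {b : Z ⟶ X}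
    (e : (⟨Y, a⟩ : Σ Y : C, Y ⟶ X) = ⟨Z, b⟩) : a = eqToHom (congrArg Sigma.fst e) ≫ b := by
  cases e; simp

theorem qTo_id {X Γ : C} (h : ObOver X Γ) : qTo (𝟙 Γ) h = eqToHom (pull_id h) := by
  have := eq_eqToHom_of_sigma (pullAux_id _ X h.l_eq h.2)
  rw [Category.comp_id] at this
  exact this

theorem pullPair_comp {Γ'' Γ' Γ : C} (g : Γ'' ⟶ Γ') (f : Γ' ⟶ Γ) {X : C} (h : ObOver X Γ) :
    (⟨pull (g ≫ f) h, qTo (g ≫ f) h⟩ : Σ Y : C, Y ⟶ X) =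
      ⟨pull g (over_pull f h), qTo g (over_pull f h) ≫ qTo f h⟩ := by
  refine (pullAux_comp g f _ X h.l_eq h.2).trans ?_
  have e := pull_eq g (over_pull f h) (l_pull f h) (ft_iter_pull f h)
  exact congrArg (fun r : (Σ Y : C, Y ⟶ pull f h) =>
    (⟨r.1, r.2 ≫ qTo f h⟩ : Σ Y : C, Y ⟶ X)) e.symm

theorem pull_comp {Γ'' Γ' Γ : C} (g : Γ'' ⟶ Γ') (f : Γ' ⟶ Γ) {X : C} (h : ObOver X Γ) :
    pull (g ≫ f) h = pull g (over_pull f h) := congrArg Sigma.fst (pullPair_comp g f h)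

theorem qTo_comp {Γ'' Γ' Γ : C} (g : Γ'' ⟶ Γ') (f : Γ' ⟶ Γ) {X : C} (h : ObOver X Γ) :
    qTo (g ≫ f) h = eqToHom (pull_comp g f h) ≫ qTo g (over_pull f h) ≫ qTo f h :=
  eq_eqToHom_of_sigma (pullPair_comp g f h)

theorem over_ft {X Γ : C} (h : ObOver X Γ) (hlt : l Γ < l X) : ObOver (ft X) Γ := by
  obtain ⟨n, hn⟩ : ∃ n, l X - l Γ = n + 1 := ⟨l X - l Γ - 1, by omega⟩
  have h2 := h.2
  rw [hn] at h2
  exact over_of_iter (n := n) (by rw [l_ft X (by omega)]; omega) h2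

theorem pTo_eq_p_comp {X Γ : C} (h : ObOver X Γ) (hlt : l Γ < l X) :
    pTo h = p X rfl ≫ pTo (over_ft h hlt) := by
  obtain ⟨n, hn⟩ : ∃ n, l X - l Γ = n + 1 := ⟨l X - l Γ - 1, by omega⟩
  have h2 := h.2
  rw [hn] at h2
  rw [pTo_eq h (n := n + 1) (by omega) h2,
    pTo_eq (over_ft h hlt) (n := n) (by rw [l_ft X (by omega)]; omega) h2]
  rfl

theorem pull_eq_pb {Γ' Γ : C} (f : Γ' ⟶ Γ) {X : C} (h : ObOver X Γ) (hlt : l Γ < l X) :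
    (⟨pull f h, qTo f h⟩ : Σ Y : C, Y ⟶ X) =
      ⟨pb (qTo f (over_ft h hlt)) X rfl (by omega), q (qTo f (over_ft h hlt)) X rfl (by omega)⟩ := by
  obtain ⟨n, hn⟩ : ∃ n, l X - l Γ = n + 1 := ⟨l X - l Γ - 1, by omega⟩
  have h2 := h.2
  rw [hn] at h2
  rw [pull_eq f h (n := n + 1) (by omega) h2]
  exact pullPair_congr rfl (by omega)
    (pull_eq f (over_ft h hlt) (n := n) (by rw [l_ft X (by omega)]; omega) h2).symm

theorem ft_pull {Γ' Γ : C} (f : Γ' ⟶ Γ) {X : C} (h : ObOver X Γ) (hlt : l Γ < l X) :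
    ft (pull f h) = pull f (over_ft h hlt) := by
  have e : pull f h = _ := congrArg Sigma.fst (pull_eq_pb f h hlt)
  rw [e]
  exact ft_pb _ _ _ _

theorem qTo_comp_p {Γ' Γ : C} (f : Γ' ⟶ Γ) {X : C} (h : ObOver X Γ) (hlt : l Γ < l X) :
    qTo f h ≫ p X rfl = p (pull f h) (ft_pull f h hlt) ≫ qTo f (over_ft h hlt) := by
  rw [eq_eqToHom_of_sigma (pull_eq_pb f h hlt), Category.assoc, q_comp_p, ← Category.assoc,
    eqToHom_p]

/-- `f^*(a) : f^*(X) ⟶ f^*(Y)` for a morphism `a : X ⟶ Y` over `Γ`: the unique morphism over `Γ'`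
with `f^*(a) ≫ q(f, Y) = q(f, X) ≫ a`. -/
noncomputable def baseChange {Γ' Γ : C} (f : Γ' ⟶ Γ) {X Y : C} {hX : ObOver X Γ} {hY : ObOver Y Γ}
    (a : X ⟶ Y) (ha : IsOver hX hY a) : pull f hX ⟶ pull f hY :=
  (isPullback_pull f hY).lift (qTo f hX ≫ a) (pTo (over_pull f hX)) (by
    rw [Category.assoc, show a ≫ pTo hY = pTo hX from ha]
    exact (isPullback_pull f hX).w)

theorem baseChange_qTo {Γ' Γ : C} (f : Γ' ⟶ Γ) {X Y : C} {hX : ObOver X Γ} {hY : ObOver Y Γ}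
    (a : X ⟶ Y) (ha : IsOver hX hY a) : baseChange f a ha ≫ qTo f hY = qTo f hX ≫ a :=
  (isPullback_pull f hY).lift_fst _ _ _

theorem baseChange_pTo {Γ' Γ : C} (f : Γ' ⟶ Γ) {X Y : C} {hX : ObOver X Γ} {hY : ObOver Y Γ}
    (a : X ⟶ Y) (ha : IsOver hX hY a) :
    IsOver (over_pull f hX) (over_pull f hY) (baseChange f a ha) :=
  (isPullback_pull f hY).lift_snd _ _ _

theorem over_fprod {X Y Γ : C} (hX : ObOver X Γ) (hY : ObOver Y Γ) : ObOver (pull (pTo hX) hY) X :=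
  over_pull _ _

/-- The fibre product `X ×_Γ Y = p(X, Γ)^*(Y)` of two objects over `Γ`. -/
abbrev fprod {X Y Γ : C} (hX : ObOver X Γ) (hY : ObOver Y Γ) : C := pull (pTo hX) hY

/-- The exchange isomorphism `exch(X, Y; Γ) : X ×_Γ Y ⟶ Y ×_Γ X`. -/
noncomputable def exch {X Y Γ : C} (hX : ObOver X Γ) (hY : ObOver Y Γ) : fprod hX hY ⟶
    fprod hY hX :=
  (isPullback_pull (pTo hY) hX).lift (pTo (over_pull (pTo hX) hY)) (qTo (pTo hX) hY)
    (isPullback_pull (pTo hX) hY).w.symm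

/-- `∂⁻¹(X)`: the sections of `p_X : X ⟶ ft X`, where `l X > 0`. -/
@[ext]
structure Sections (X : C) where
  hom : ft X ⟶ X
  hom_p : hom ≫ p X rfl = 𝟙 (ft X)
  pos : 0 < l X

theorem Sections.hom_p_of_eq {X Δ : C} (t : Sections X) (e : ft X = Δ) :
    t.hom ≫ p X e = eqToHom e := by
  subst e; simpa using t.hom_p

theorem Sections.isOver {X Γ : C} (t : Sections X) (h : ObOver X Γ) (hlt : l Γ < l X) :
    IsOver (over_ft h hlt) h t.hom := by
  unfold IsOver
  rw [pTo_eq_p_comp h hlt, ← Category.assoc, t.hom_p, Category.id_comp]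

theorem comp_p_of_eq {X Z Δ : C} (e : ft X = Δ) (a : Z ⟶ X) :
    a ≫ p X rfl = (a ≫ p X e) ≫ eqToHom e.symm := by
  subst e; simp

theorem lt_l_pull {Γ' Γ : C} (f : Γ' ⟶ Γ) {X : C} (h : ObOver X Γ) (hlt : l Γ < l X) :
    l Γ' < l (pull f h) := by
  rw [l_pull]; omega

theorem pTo_pull {Γ' Γ : C} (f : Γ' ⟶ Γ) {X : C} (h : ObOver X Γ) (hlt : l Γ < l X) :
    pTo (over_pull f h) =
      p (pull f h) (ft_pull f h hlt) ≫ pTo (over_pull f (over_ft h hlt)) := by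
  rw [pTo_eq_p_comp _ (lt_l_pull f h hlt)]
  have : ∀ {Δ : C} (e : ft (pull f h) = Δ) (h1 : ObOver (ft (pull f h)) Γ') (h2 : ObOver Δ Γ'),
      p (pull f h) rfl ≫ pTo h1 = p (pull f h) e ≫ pTo h2 := by
    intro Δ e h1 h2; subst e; rfl
  exact this _ _ _

theorem baseChange_section {Γ' Γ : C} (f : Γ' ⟶ Γ) {X : C} (h : ObOver X Γ) (hlt : l Γ < l X)
    (t : Sections X) :
    baseChange f t.hom (t.isOver h hlt) ≫ p (pull f h) (ft_pull f h hlt) = 𝟙 _ := by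
  apply (isPullback_pull f (over_ft h hlt)).hom_ext
  · rw [Category.assoc, ← qTo_comp_p f h hlt, ← Category.assoc, baseChange_qTo, Category.assoc, t.hom_p]
    simp
  · rw [Category.assoc, ← pTo_pull f h hlt, Category.id_comp]
    exact baseChange_pTo _ _ _

/-- `f^*(t) ∈ ∂⁻¹(f^*(X))` for `t ∈ ∂⁻¹(X)` and `X > Γ`; its domain `f^*(ft X)` equals
`ft (f^*(X))`. -/
noncomputable def Sections.pull {Γ' Γ : C} (f : Γ' ⟶ Γ) {X : C} (h : ObOver X Γ) (hlt : l Γ < l X)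
    (t : Sections X) : Sections (pull f h) where
  hom := eqToHom (ft_pull f h hlt) ≫ baseChange f t.hom (t.isOver h hlt)
  hom_p := by
    rw [Category.assoc, comp_p_of_eq (ft_pull f h hlt),
      baseChange_section f h hlt t, Category.id_comp, eqToHom_trans, eqToHom_refl]
  pos := by rw [l_pull]; omega

theorem Sections.pull_hom_qTo {Γ' Γ : C} (f : Γ' ⟶ Γ) {X : C} (h : ObOver X Γ) (hlt : l Γ < l X)
    (t : Sections X) : (t.pull f h hlt).hom ≫ qTo f h =
      eqToHom (ft_pull f h hlt) ≫ qTo f (over_ft h hlt) ≫ t.hom := by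
  simp only [Sections.pull, Category.assoc, baseChange_qTo]

theorem Sections.ext_qTo {Γ' Γ : C} {f : Γ' ⟶ Γ} {X : C} {h : ObOver X Γ} (hlt : l Γ < l X)
    {t t' : Sections (CSystem.pull f h)} (e : t.hom ≫ qTo f h = t'.hom ≫ qTo f h) : t = t' := by
  apply Sections.ext
  apply (isPullback_pull f h).hom_ext e
  rw [pTo_eq_p_comp _ (lt_l_pull f h hlt), ← Category.assoc, ← Category.assoc, t.hom_p, t'.hom_p]

theorem Sections.heq_of_hom {X Y : C} (e : X = Y) {t : Sections X} {t' : Sections Y}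
    (h : t.hom ≫ eqToHom e = eqToHom (congrArg ft e) ≫ t'.hom) : t ≍ t' := by
  subst e
  simp only [eqToHom_refl, Category.comp_id, Category.id_comp] at h
  exact heq_of_eq (Sections.ext h)

theorem Sections.pull_id {X Γ : C} (h : ObOver X Γ) (hlt : l Γ < l X) (t : Sections X) :
    t.pull (𝟙 Γ) h hlt ≍ t := by
  apply Sections.heq_of_hom (CSystem.pull_id h)
  rw [← qTo_id, Sections.pull_hom_qTo, qTo_id, ← Category.assoc, eqToHom_trans]

theorem qTo_congr {Γ' Γ : C} (f : Γ' ⟶ Γ) {X Y : C} (e : X = Y) (hX : ObOver X Γ) (hY : ObOver Y Γ) :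
    qTo f hX ≫ eqToHom e = eqToHom (by subst e; rfl) ≫ qTo f hY := by
  subst e; simp

theorem Sections.pull_comp {Γ'' Γ' Γ : C} (g : Γ'' ⟶ Γ') (f : Γ' ⟶ Γ) {X : C} (h : ObOver X Γ)
    (hlt : l Γ < l X) (t : Sections X) : t.pull (g ≫ f) h hlt ≍
      (t.pull f h hlt).pull g (over_pull f h) (lt_l_pull f h hlt) := by
  have cast : ∀ {Z W : C} (e : Z = W) (r : Sections W), ∃ r' : Sections Z, r' ≍ r ∧
      r'.hom = eqToHom (congrArg ft e) ≫ r.hom ≫ eqToHom e.symm := by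
    intro Z W e r; subst e; exact ⟨r, HEq.rfl, by simp⟩
  obtain ⟨r', h1, h2⟩ := cast (CSystem.pull_comp g f h)
    ((t.pull f h hlt).pull g (over_pull f h) (lt_l_pull f h hlt))
  refine HEq.trans (heq_of_eq ?_) h1
  apply Sections.ext_qTo hlt
  rw [h2, Sections.pull_hom_qTo, qTo_comp, qTo_comp]
  simp only [Category.assoc, eqToHom_trans_assoc, eqToHom_refl, Category.id_comp]
  rw [← Category.assoc _ (qTo g (over_pull f h)), Sections.pull_hom_qTo]
  simp only [Category.assoc]
  rw [Sections.pull_hom_qTo, ← Category.assoc (qTo g _) (eqToHom _),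
    qTo_congr g (ft_pull f h hlt) _ (over_pull f (over_ft h hlt))]
  simp

theorem over_of_ft {X Γ : C} (h : ft X = Γ) : ObOver X Γ := by
  rcases Nat.eq_zero_or_pos (l X) with h0 | h0
  · have hX := (l_eq_zero_iff X).1 h0
    have : X = Γ := by rw [← h, hX, ft_pt]
    exact over_of_iter (n := 0) (by rw [this]; rfl) this
  · exact over_of_iter (n := 1) (by rw [← h, l_ft X h0]; omega) h

theorem pTo_of_ft {X Γ : C} (h : ft X = Γ) (h0 : 0 < l X) (hX : ObOver X Γ) :
    pTo hX = p X h := by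
  refine (pTo_eq hX (n := 1) (by rw [← h, l_ft X h0]; omega) h).trans ?_
  refine (pAux_of_ft (n := 0) h h).trans ?_
  exact Category.comp_id _

theorem pull_self {Γ' Γ X : C} (f : Γ' ⟶ Γ) (e : X = Γ) (h : ObOver X Γ) : pull f h = Γ' :=
  congrArg Sigma.fst (pull_eq f h (n := 0) (by rw [e]; rfl) e)

theorem pull_eqToHom {Γ' Γ X : C} (e : Γ' = Γ) (h : ObOver X Γ) : pull (eqToHom e) h = X := by
  subst e; exact pull_id h

theorem qTo_eqToHom {Γ' Γ X : C} (e : Γ' = Γ) (h : ObOver X Γ) :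
    qTo (eqToHom e) h = eqToHom (pull_eqToHom e h) := by
  subst e; exact qTo_id h

theorem pAux_add {Y Γ : C} (n : ℕ) : ∀ (m : ℕ) (X : C) (h1 : ft^[m] X = Y) (h2 : ft^[n] Y = Γ)
    (h3 : ft^[m + n] X = Γ), pAux (m + n) X h3 = pAux m X h1 ≫ pAux n Y h2
  | 0, X, h1, h2, h3 => by
    have h1' : X = Y := h1
    subst h1'
    have : ∀ k (hk : k = n) (h4 : ft^[k] X = Γ), pAux k X h4 = pAux n X h2 := by
      intro k hk h4; subst hk; rfl
    rw [this _ (by omega) h3]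
    exact (Category.id_comp _).symm
  | m + 1, X, h1, h2, h3 => by
    have : ∀ k (hk : k = m + n + 1) (h4 : ft^[k] X = Γ), pAux k X h4 =
        pAux (m + n + 1) X (by subst hk; exact h4) := by
      intro k hk h4; subst hk; rfl
    refine (this _ (by omega) h3).trans ?_
    have h4 : ft^[m + n] (ft X) = Γ := by
      rw [← h3, show m + 1 + n = m + n + 1 by omega]; rfl
    exact (congrArg (p X rfl ≫ ·) (pAux_add n m (ft X) h1 h2 h4)).trans
      (Category.assoc _ _ _).symm

theorem iter_trans {X Y Γ : C} (h1 : ObOver X Y) (h2 : ObOver Y Γ) :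
    ft^[(l X - l Y) + (l Y - l Γ)] X = Γ := by
  rw [Nat.add_comm, Function.iterate_add_apply, h1.2, h2.2]

theorem over_trans {X Y Γ : C} (h1 : ObOver X Y) (h2 : ObOver Y Γ) : ObOver X Γ :=
  over_of_iter (n := (l X - l Y) + (l Y - l Γ)) (by have := h1.1; have := h2.1; omega)
    (iter_trans h1 h2)

theorem pTo_trans {X Y Γ : C} (h1 : ObOver X Y) (h2 : ObOver Y Γ) (h3 : ObOver X Γ) :
    pTo h3 = pTo h1 ≫ pTo h2 := by
  rw [pTo_eq h3 (n := (l X - l Y) + (l Y - l Γ)) (by have := h1.1; have := h2.1; omega)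
    (iter_trans h1 h2)]
  exact pAux_add _ _ X h1.2 h2.2 _

theorem IsOver.trans {X Y Z Γ : C} {hX : ObOver X Z} {hY : ObOver Y Z} {a : X ⟶ Y}
    (ha : IsOver hX hY a) (hZ : ObOver Z Γ) (hX' : ObOver X Γ) (hY' : ObOver Y Γ) :
    IsOver hX' hY' a := by
  unfold IsOver at *
  rw [pTo_trans hY hZ, pTo_trans hX hZ, ← Category.assoc, ha]

/-! ### The presheaves `Ob_n`, `Õb_n` and `∂ : Õb_n ⟶ Ob_n` -/

/-- `Ob_n(Γ)`. -/
@[ext]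
structure ObN (n : ℕ) (Γ : C) : Type (max u v) where
  obj : C
  l_obj : l obj = l Γ + n
  ft_obj : ft^[n] obj = Γ

theorem ObN.over {n : ℕ} {Γ : C} (X : ObN n Γ) : ObOver X.obj Γ := over_of_iter X.l_obj X.ft_obj

/-- `f^* : Ob_n(Γ) → Ob_n(Γ')`. -/
def ObN.pull {n : ℕ} {Γ' Γ : C} (f : Γ' ⟶ Γ) (X : ObN n Γ) : ObN n Γ' where
  obj := CSystem.pull f X.over
  l_obj := by rw [l_pull, X.l_obj]; omega
  ft_obj := by
    have h := ft_iter_pull f X.over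
    rwa [show l X.obj - l Γ = n by rw [X.l_obj]; omega] at h

/-- `Õb_n(Γ)`: the sections `o` of `p_{codom(o)}` with `codom(o) ∈ Ob_n(Γ)` and `codom(o) > Γ`. -/
@[ext]
structure TObN (n : ℕ) (Γ : C) : Type (max u v) where
  cod : ObN n Γ
  sec : Sections cod.obj
  above : l Γ < l cod.obj

/-- `f^* : Õb_n(Γ) → Õb_n(Γ')`. -/
noncomputable def TObN.pull {n : ℕ} {Γ' Γ : C} (f : Γ' ⟶ Γ) (o : TObN n Γ) : TObN n Γ' where
  cod := o.cod.pull f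
  sec := o.sec.pull f o.cod.over o.above
  above := lt_l_pull f o.cod.over o.above

theorem TObN.ext_heq {n : ℕ} {Γ : C} {o o' : TObN n Γ} (h : o.cod.obj = o'.cod.obj)
    (h' : o.sec ≍ o'.sec) : o = o' := by
  obtain ⟨⟨X, _, _⟩, t, _⟩ := o
  obtain ⟨⟨X', _, _⟩, t', _⟩ := o'
  dsimp only at h h'
  subst h
  obtain rfl := eq_of_heq h'
  rfl

theorem ObN.pull_id {n : ℕ} {Γ : C} (X : ObN.{v, u} n Γ) : X.pull (𝟙 Γ) = X :=
  ObN.ext (CSystem.pull_id X.over)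

theorem ObN.pull_comp {n : ℕ} {Γ'' Γ' Γ : C} (g : Γ'' ⟶ Γ') (f : Γ' ⟶ Γ) (X : ObN.{v, u} n Γ) :
    X.pull (g ≫ f) = (X.pull f).pull g :=
  ObN.ext (CSystem.pull_comp g f X.over)

theorem TObN.pull_id {n : ℕ} {Γ : C} (o : TObN.{v, u} n Γ) : o.pull (𝟙 Γ) = o :=
  TObN.ext_heq (CSystem.pull_id o.cod.over) (o.sec.pull_id o.cod.over o.above)

theorem TObN.pull_comp {n : ℕ} {Γ'' Γ' Γ : C} (g : Γ'' ⟶ Γ') (f : Γ' ⟶ Γ) (o : TObN.{v, u} n Γ) :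
    o.pull (g ≫ f) = (o.pull f).pull g :=
  TObN.ext_heq (CSystem.pull_comp g f o.cod.over) (o.sec.pull_comp g f o.cod.over o.above)

open Opposite

variable (C) in
/-- The presheaf `Ob_n`. -/
def obPresheaf (n : ℕ) : Cᵒᵖ ⥤ Type (max u v) where
  obj Γ := ObN n Γ.unop
  map f := TypeCat.ofHom (fun X => X.pull f.unop)
  map_id Γ := by
    apply ConcreteCategory.hom_ext
    intro X
    exact ObN.pull_id X
  map_comp f g := by
    apply ConcreteCategory.hom_ext
    intro X
    exact ObN.pull_comp g.unop f.unop X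

variable (C) in
/-- The presheaf `Õb_n`. -/
noncomputable def tobPresheaf (n : ℕ) : Cᵒᵖ ⥤ Type (max u v) where
  obj Γ := TObN n Γ.unop
  map f := TypeCat.ofHom (fun o => o.pull f.unop)
  map_id Γ := by
    apply ConcreteCategory.hom_ext
    intro o
    exact TObN.pull_id o
  map_comp f g := by
    apply ConcreteCategory.hom_ext
    intro o
    exact TObN.pull_comp g.unop f.unop o

variable (C) in
/-- `∂ : Õb_n ⟶ Ob_n`, `∂(o) = codom(o)`. -/
noncomputable def bd (n : ℕ) : tobPresheaf.{v, u} C n ⟶ obPresheaf.{v, u} C n where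
  app Γ := TypeCat.ofHom (fun o : TObN n Γ.unop => o.cod)
  naturality _ _ _ := rfl

/-! ### Cartmell–Streicher structures -/

variable (C) in
/-- `Ob_{≥ 2}`. -/
abbrev ObGE2 : Type u := {B : C // 2 ≤ l B}

/-- `A = ft(B)`. -/
abbrev ObGE2.A (B : ObGE2.{v, u} C) : C := ft B.1

/-- `Γ = ft(ft(B))`. -/
abbrev ObGE2.Γ (B : ObGE2.{v, u} C) : C := ft (ft B.1)

theorem ObGE2.l_A (B : ObGE2.{v, u} C) : l B.A = l B.1 - 1 := l_ft _ (by have := B.2; omega)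

theorem ObGE2.l_Γ (B : ObGE2.{v, u} C) : l B.Γ = l B.1 - 2 := by
  have := B.2
  have h : l (ft B.1) = l B.1 - 1 := B.l_A
  have h' : l (ft (ft B.1)) = l (ft B.1) - 1 := l_ft _ (by omega)
  change l (ft (ft B.1)) = _
  omega

theorem ObGE2.overA (B : ObGE2.{v, u} C) : ObOver B.1 B.A := over_of_ft rfl

theorem ObGE2.A_overΓ (B : ObGE2.{v, u} C) : ObOver B.A B.Γ := over_of_ft rfl

/-- `B` as an element of `Ob_2(Γ)`. -/
def ObGE2.toObN (B : ObGE2.{v, u} C) : ObN.{v, u} 2 B.Γ :=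
  ⟨B.1, by have := B.2; have := B.l_Γ; omega, rfl⟩

theorem ObGE2.overΓ (B : ObGE2.{v, u} C) : ObOver B.1 B.Γ := B.toObN.over

/-- `f^*(B) ∈ Ob_{≥ 2}` for `f : Γ' ⟶ Γ`. -/
def ObGE2.pull (B : ObGE2.{v, u} C) {Γ' : C} (f : Γ' ⟶ B.Γ) : ObGE2.{v, u} C :=
  ⟨CSystem.pull f B.overΓ, by rw [l_pull, B.l_Γ]; have := B.2; omega⟩

variable (C) in
/-- A function `Π : Ob_{≥ 2} → Ob` with `ft(Π(B)) = Γ` that is stable under base change. -/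
@[ext]
structure PiFun where
  toFun : ObGE2.{v, u} C → C
  ft_toFun : ∀ B, ft (toFun B) = B.Γ
  pull_toFun : ∀ (B : ObGE2.{v, u} C) {Γ' : C} (f : Γ' ⟶ B.Γ),
    pull f (over_of_ft (ft_toFun B)) = toFun (B.pull f)

theorem PiFun.over (P : PiFun.{v, u} C) (B : ObGE2.{v, u} C) : ObOver (P.toFun B) B.Γ :=
  over_of_ft (P.ft_toFun B)

theorem PiFun.lt_l (P : PiFun.{v, u} C) (B : ObGE2.{v, u} C) (h : 0 < l (P.toFun B)) :
    l B.Γ < l (P.toFun B) := by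
  rw [← P.ft_toFun B, l_ft _ h]; omega

/-- `A ×_Γ Π(B)`. -/
abbrev PiFun.prod1 (P : PiFun.{v, u} C) (B : ObGE2.{v, u} C) : C := fprod B.A_overΓ (P.over B)

/-- `Π(B) ×_Γ A`. -/
abbrev PiFun.prod2 (P : PiFun.{v, u} C) (B : ObGE2.{v, u} C) : C := fprod (P.over B) B.A_overΓ

theorem PiFun.prod1_overA (P : PiFun.{v, u} C) (B : ObGE2.{v, u} C) : ObOver (P.prod1 B) B.A :=
  over_fprod _ _

theorem PiFun.prod1_overΓ (P : PiFun.{v, u} C) (B : ObGE2.{v, u} C) : ObOver (P.prod1 B) B.Γ :=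
  over_trans (P.prod1_overA B) B.A_overΓ

theorem PiFun.prod2_overΓ (P : PiFun.{v, u} C) (B : ObGE2.{v, u} C) : ObOver (P.prod2 B) B.Γ :=
  over_trans (over_fprod _ _) (P.over B)

theorem PiFun.ft_prod1 (P : PiFun.{v, u} C) (B : ObGE2.{v, u} C) (h : 0 < l (P.toFun B)) :
    ft (P.prod1 B) = B.A := by
  rw [ft_pull _ _ (P.lt_l B h)]
  exact pull_self _ (P.ft_toFun B) _

/-- `λinv_B(t) = p_A^*(t) ≫ Ap_B` for `Ap_B : A ×_Γ Π(B) ⟶ B` over `A`. -/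
noncomputable def lamInv1 (P : PiFun.{v, u} C) (B : ObGE2.{v, u} C) (a : P.prod1 B ⟶ B.1)
    (ha : IsOver (P.prod1_overA B) B.overA a) (t : Sections (P.toFun B)) : Sections B.1 where
  hom := eqToHom (P.ft_prod1 B t.pos).symm ≫
    (t.pull (pTo B.A_overΓ) (P.over B) (P.lt_l B t.pos)).hom ≫ a
  hom_p := by
    have hB : 0 < l B.1 := by have := B.2; omega
    have h1 : a ≫ p B.1 rfl = p (P.prod1 B) (P.ft_prod1 B t.pos) := by
      rw [← pTo_of_ft rfl hB B.overA, show a ≫ pTo B.overA = _ from ha]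
      exact pTo_of_ft _ (t.pull (pTo B.A_overΓ) (P.over B) (P.lt_l B t.pos)).pos _
    rw [Category.assoc, Category.assoc, h1, Sections.hom_p_of_eq]
    simp
  pos := by have := B.2; omega

/-- The families `Ap` that form a Cartmell–Streicher structure together with `Π`. -/
@[ext]
structure AllAp1 (P : PiFun.{v, u} C) where
  Ap : ∀ B : ObGE2.{v, u} C, P.prod1 B ⟶ B.1
  over_A : ∀ B, IsOver (P.prod1_overA B) B.overA (Ap B)
  stable : ∀ (B : ObGE2.{v, u} C) {Γ' : C} (f : Γ' ⟶ B.Γ),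
    Arrow.mk (baseChange f (Ap B) ((over_A B).trans B.A_overΓ (P.prod1_overΓ B) B.overΓ)) =
      Arrow.mk (Ap (B.pull f))
  bij : ∀ B, Function.Bijective (lamInv1 P B (Ap B) (over_A B))

variable (C) in
/-- A Cartmell–Streicher structure (products of families of types). -/
@[ext]
structure CartmellStreicher where
  Pi : PiFun.{v, u} C
  Ap : AllAp1 Pi

/-! ### `(Π, λ)`-structures -/

variable (C) in
/-- A `(Π, λ)`-structure: the square formed by `λ`, the two `∂` and `Π` is a pullback. -/
@[ext]
structure PiLambda where
  Pi : obPresheaf.{v, u} C 2 ⟶ obPresheaf.{v, u} C 1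
  lam : tobPresheaf.{v, u} C 2 ⟶ tobPresheaf.{v, u} C 1
  isPullback : IsPullback lam (bd C 2) (bd C 1) Pi

/-- The `λ` that form a `(Π, λ)`-structure together with `Π`. -/
abbrev AllLam1 (Pi : obPresheaf.{v, u} C 2 ⟶ obPresheaf.{v, u} C 1) :=
  {lam : tobPresheaf.{v, u} C 2 ⟶ tobPresheaf.{v, u} C 1 // IsPullback lam (bd C 2) (bd C 1) Pi}

/-! ### The intermediate sets -/

/-- The fibre `∂⁻¹(B)` of `∂ : Õb_n(Γ) → Ob_n(Γ)`. -/
abbrev Fib {n : ℕ} {Γ : C} (B : ObN.{v, u} n Γ) := {o : TObN.{v, u} n Γ // o.cod = B}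

/-- `f^* : ∂⁻¹(B) → ∂⁻¹(f^*(B))`. -/
noncomputable def fibPull {n : ℕ} {Γ' Γ : C} (f : Γ' ⟶ Γ) {B : ObN.{v, u} n Γ} (o : Fib B) :
    Fib (B.pull f) :=
  ⟨o.1.pull f, congrArg (ObN.pull f) o.2⟩

/-- A section of `p_B` as an element of the fibre over `B ∈ Ob_n(Γ)`, `n > 0`. -/
def fibMk {n : ℕ} (hn : 0 < n) {Γ : C} (B : ObN.{v, u} n Γ) (t : Sections B.obj) : Fib B :=
  ⟨⟨B, t, by have := B.l_obj; omega⟩, rfl⟩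

/-- Natural double families of bijections `∂⁻¹(B) → ∂⁻¹(Π_Γ(B))`. -/
@[ext]
structure AllLam2 (Pi : obPresheaf.{v, u} C 2 ⟶ obPresheaf.{v, u} C 1) where
  lam : ∀ (Γ : C) (B : ObN.{v, u} 2 Γ), Fib B → Fib (Pi.app (op Γ) B : ObN.{v, u} 1 Γ)
  bij : ∀ Γ B, Function.Bijective (lam Γ B)
  natural : ∀ {Γ' Γ : C} (f : Γ' ⟶ Γ) (B : ObN.{v, u} 2 Γ) (o : Fib B),
    (fibPull f (lam Γ B o)).1 = (lam Γ' (B.pull f) (fibPull f o)).1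

theorem isOver_of_eq {P : PiFun.{v, u} C} {B : ObGE2.{v, u} C} {a : P.prod2 B ⟶ B.1}
    (ha : a ≫ p B.1 rfl = qTo (pTo (P.over B)) B.A_overΓ) :
    IsOver (P.prod2_overΓ B) B.overΓ a := by
  have hB : 0 < l B.1 := by have := B.2; omega
  unfold IsOver
  rw [pTo_trans B.overA B.A_overΓ, pTo_of_ft rfl hB B.overA, ← Category.assoc, ha,
    (isPullback_pull (pTo (P.over B)) B.A_overΓ).w]
  exact (pTo_trans (over_fprod _ _) (P.over B) _).symm

theorem Sections.comp_pTo {P : PiFun.{v, u} C} {B : ObGE2.{v, u} C} (t : Sections (P.toFun B)) :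
    t.hom ≫ pTo (P.over B) = eqToHom (P.ft_toFun B) := by
  rw [pTo_of_ft (P.ft_toFun B) t.pos, t.hom_p_of_eq]

theorem pull_congr_hom {Γ' Γ X : C} {f g : Γ' ⟶ Γ} (e : f = g) (h : ObOver X Γ) :
    pull f h = pull g h := by rw [e]

theorem qTo_congr_hom {Γ' Γ X : C} {f g : Γ' ⟶ Γ} (e : f = g) (h : ObOver X Γ) :
    qTo f h = eqToHom (pull_congr_hom e h) ≫ qTo g h := by subst e; simp

theorem pull_prod2 {P : PiFun.{v, u} C} {B : ObGE2.{v, u} C} (t : Sections (P.toFun B)) :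
    pull t.hom (over_fprod (P.over B) B.A_overΓ) = B.A :=
  (pull_comp t.hom (pTo (P.over B)) B.A_overΓ).symm.trans
    ((pull_congr_hom t.comp_pTo _).trans (pull_eqToHom (P.ft_toFun B) B.A_overΓ))

/-- `λinv_B(t) = q(t, Π(B) ×_Γ A) ≫ Ap_B` for `Ap_B : Π(B) ×_Γ A ⟶ B` with
`Ap_B ≫ p_B = q(p_{Π(B)}, A)`. -/
noncomputable def lamInv2 (P : PiFun.{v, u} C) (B : ObGE2.{v, u} C) (a : P.prod2 B ⟶ B.1)
    (ha : a ≫ p B.1 rfl = qTo (pTo (P.over B)) B.A_overΓ) (t : Sections (P.toFun B)) :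
    Sections B.1 where
  hom := eqToHom (pull_prod2 t).symm ≫ qTo t.hom (over_fprod (P.over B) B.A_overΓ) ≫ a
  hom_p := by
    have h := qTo_comp t.hom (pTo (P.over B)) B.A_overΓ
    rw [qTo_congr_hom t.comp_pTo, qTo_eqToHom, eqToHom_trans] at h
    have h2 : qTo t.hom (over_fprod (P.over B) B.A_overΓ) ≫ qTo (pTo (P.over B)) B.A_overΓ =
        eqToHom (pull_prod2 t) := by
      rw [← cancel_epi (eqToHom (pull_comp t.hom (pTo (P.over B)) B.A_overΓ))]
      exact h.symm.trans (eqToHom_trans _ _).symm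
    rw [Category.assoc, Category.assoc, ha]
    exact (congrArg _ h2).trans (eqToHom_trans _ _)
  pos := by have := B.2; omega

/-- The families `Ap_B : Π(B) ×_Γ A ⟶ B`. -/
@[ext]
structure AllAp2 (P : PiFun.{v, u} C) where
  Ap : ∀ B : ObGE2.{v, u} C, P.prod2 B ⟶ B.1
  comp_p : ∀ B, Ap B ≫ p B.1 rfl = qTo (pTo (P.over B)) B.A_overΓ
  stable : ∀ (B : ObGE2.{v, u} C) {Γ' : C} (f : Γ' ⟶ B.Γ),
    Arrow.mk (baseChange f (Ap B) (isOver_of_eq (comp_p B))) = Arrow.mk (Ap (B.pull f))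
  bij : ∀ B, Function.Bijective (lamInv2 P B (Ap B) (comp_p B))

theorem app_obj_eq (Pi : obPresheaf.{v, u} C 2 ⟶ obPresheaf.{v, u} C 1) {Γ : C}
    (X : ObN.{v, u} 2 Γ) (h : 2 ≤ l X.obj) : (Pi.app (op Γ) X : ObN.{v, u} 1 Γ).obj =
      (Pi.app (op _) (ObGE2.toObN ⟨X.obj, h⟩) : ObN.{v, u} 1 _).obj := by
  obtain ⟨X, h1, h2⟩ := X
  have h2' : ft (ft X) = Γ := h2
  subst h2'
  rfl

/-- `Φ(Π)(B) = Π_Γ(B)`. -/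
def phi (Pi : obPresheaf.{v, u} C 2 ⟶ obPresheaf.{v, u} C 1) : PiFun.{v, u} C where
  toFun B := (Pi.app (op B.Γ) B.toObN : ObN.{v, u} 1 B.Γ).obj
  ft_toFun B := (Pi.app (op B.Γ) B.toObN : ObN.{v, u} 1 B.Γ).ft_obj
  pull_toFun B Γ' f := by
    have h := ConcreteCategory.congr_hom (Pi.naturality f.op) B.toObN
    exact (congrArg ObN.obj h.symm).trans (app_obj_eq Pi (B.toObN.pull f) _)

theorem phi_pos (Pi : obPresheaf.{v, u} C 2 ⟶ obPresheaf.{v, u} C 1) (B : ObGE2.{v, u} C) :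
    0 < l ((phi Pi).toFun B) := by
  have := (Pi.app (op B.Γ) B.toObN : ObN.{v, u} 1 B.Γ).l_obj
  change 0 < l (Pi.app (op B.Γ) B.toObN : ObN.{v, u} 1 B.Γ).obj
  omega

/-- `p_{Π(B)} : Π(B) ⟶ Γ` for `Π : Ob_2 ⟶ Ob_1`. -/
def pPi (Pi : obPresheaf.{v, u} C 2 ⟶ obPresheaf.{v, u} C 1) (B : ObGE2.{v, u} C) :
    (phi Pi).toFun B ⟶ B.Γ := pTo ((phi Pi).over B)

/-- The diagonal `δ = s_{Id_{Π(B)}} : Π(B) ⟶ Π(B) ×_Γ Π(B)`. -/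
def diag (Pi : obPresheaf.{v, u} C 2 ⟶ obPresheaf.{v, u} C 1) (B : ObGE2.{v, u} C) :
    (phi Pi).toFun B ⟶ pb (𝟙 _ ≫ p ((phi Pi).toFun B) rfl) _ rfl (phi_pos Pi B) :=
  s (𝟙 ((phi Pi).toFun B)) (phi_pos Pi B)

end CSystem

namespace CSystem

open C0System Opposite

variable {C : Type u} [CSystem.{v} C]

/-! The heart is a Yoneda argument for part (iii). Over `Π(B)` the object `Π(B) ×_Γ B` has product
`Π(B) ×_Γ Π(B)`, and this carries a generic section, the diagonal. Every section `t` of `p_{Π(B)}`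
is the base change of the diagonal along `t` itself, and the same base change takes `Π(B) ×_Γ B`
back to `B` (`PiFun.sectionCart`, `PiFun.sectionCart_rel`). A stable family of bijections `λ` is
therefore determined by the one section `ap` that it sends to the diagonal: `λ⁻¹(t)` is the base
change of `ap` along `t`, which is the graph `A ⟶ Π(B) ×_Γ A` of `t` followed by the evaluation
built from `ap` (`NatLam.lamInv2_eval`). Conversely, `λinv` of a stable family `Ap` is stable, so
its inverse is a stable `λ`, and its value at the diagonal returns `Ap` because the graph of the
diagonal projects to the identity (`PiFun.graph_diagSection`).

The other parts are reformulations. For (i), `Γ` is determined by `B ∈ Ob_2(Γ)` as `ft²(B)`; what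
needs an argument is that `Π(B)` has positive length (`PiFun.pos`). For (ii), pullbacks of
presheaves are computed objectwise, and a square of sets is a pullback iff it is bijective on
fibres. For (iv), both forms of `λinv` reduce to the graph of the section. Part (v) assembles these
over `Φ`.

Base changes compose strictly, but only up to propositional equality of objects. The proof therefore
replaces "the pullback of `B` along `f`" by the relation "`B'` is presented as `g^*(B)`" (`Cart`),
and pulled back sections by the relations `SecRel` and `PiRel`. Stability becomes commutativity of
ordinary squares (`stable_iff`). -/

/-! ### Iterated base change, fibre products and the exchange isomorphism. -/

theorem eqToHom_comp_pTo {X Y Γ : C} (e : X = Y) (h : ObOver Y Γ) (h' : ObOver X Γ) :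
    eqToHom e ≫ pTo h = pTo h' := by
  subst e; simp

theorem qTo_self {Γ' Γ X : C} (f : Γ' ⟶ Γ) (e : X = Γ) (h : ObOver X Γ) :
    qTo f h = eqToHom (pull_self f e h) ≫ f ≫ eqToHom e.symm := by
  subst e
  have h1 := pull_eq f h (n := 0) rfl rfl
  have h2 := eq_eqToHom_of_sigma h1
  exact h2

/-- The recursion removes projections from the top of `X`, so the first `m` steps agree on the two
sides, and what remains is the base change of `Y`. -/
theorem pullAux_add {Γ' Γ Y : C} (f : Γ' ⟶ Γ) {n : ℕ} (hl : l Y = l Γ + n) (h : ft^[n] Y = Γ) :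
    ∀ (m : ℕ) (X : C) (hl1 : l X = l Y + m) (h1 : ft^[m] X = Y)
      (hl2 : l X = l Γ + (n + m)) (h2 : ft^[n + m] X = Γ),
      pullAux f (n + m) X hl2 h2 = pullAux (pullAux f n Y hl h).2 m X hl1 h1
  | 0, X, hl1, h1, hl2, h2 => by
    have h1' : X = Y := h1
    subst h1'
    change pullAux f n X _ _ = ⟨_, _ ≫ 𝟙 _⟩
    simp
  | m + 1, X, hl1, h1, hl2, h2 =>
    pullPair_congr rfl (iter_ft_succ hl1 h1).2.2
      (pullAux_add f hl h m (ft X) (iter_ft_succ hl1 h1).1 (iter_ft_succ hl1 h1).2.1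
        (iter_ft_succ (n := n + m) hl2 h2).1 (iter_ft_succ (n := n + m) hl2 h2).2.1)

/-- Pulling back along `f` from `Γ` is pulling back along `q(f, Y)` from an intermediate `Y`. -/
theorem pullPair_trans {Γ' Γ X Y : C} (f : Γ' ⟶ Γ) (hX : ObOver X Y) (hY : ObOver Y Γ)
    (h : ObOver X Γ) : (⟨pull f h, qTo f h⟩ : Σ Z : C, Z ⟶ X) =
      ⟨pull (qTo f hY) hX, qTo (qTo f hY) hX⟩ := by
  have e : l X = l Γ + ((l Y - l Γ) + (l X - l Y)) := by have := hX.1; have := hY.1; omega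
  have e' : ft^[(l Y - l Γ) + (l X - l Y)] X = Γ := by
    rw [Function.iterate_add_apply, hX.2, hY.2]
  rw [pull_eq f h e e', pullAux_add f hY.l_eq hY.2 _ X hX.l_eq hX.2]
  rfl

theorem isPullback_of_eq {Γ' Δ Γ X Y : C} (f : Γ' ⟶ Γ) (h : ObOver X Γ) (e : Δ = Γ')
    (e' : Y = pull f h) (hY : ObOver Y Δ) :
    IsPullback (eqToHom e' ≫ qTo f h) (pTo hY) (pTo h) (eqToHom e ≫ f) := by
  subst e e'
  simpa using isPullback_pull f h

/-- Functoriality of `q` with all casts explicit; `Cart.comp_qA`, `Cart.comp_qB` and `Cart.comp_qPi`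
are instances. -/
theorem eqToHom_qTo_comp {Γ'' Γ' Γ X Y Z : C} (g : Γ'' ⟶ Γ') (f : Γ' ⟶ Γ) (hX : ObOver X Γ)
    (hY : ObOver Y Γ') (e : Y = pull f hX) (e' : Z = pull g hY) (e'' : Z = pull (g ≫ f) hX) :
    eqToHom e'' ≫ qTo (g ≫ f) hX = (eqToHom e' ≫ qTo g hY) ≫ eqToHom e ≫ qTo f hX := by
  subst e
  rw [qTo_comp]
  simp

theorem eqToHom_qTo_congr {Γ' Γ X Y : C} {f g : Γ' ⟶ Γ} (e : f = g) (h : ObOver X Γ)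
    (e' : Y = pull f h) (e'' : Y = pull g h) :
    eqToHom e' ≫ qTo f h = eqToHom e'' ≫ qTo g h := by
  subst e; rfl

theorem eqToHom_qTo_id {Γ X Y : C} {f : Γ ⟶ Γ} (e : f = 𝟙 Γ) (h : ObOver X Γ)
    (e' : Y = pull f h) : eqToHom e' ≫ qTo f h = eqToHom (by subst e; rw [e', pull_id]) := by
  subst e
  rw [qTo_id, eqToHom_trans]

theorem sigma_mk_eqToHom_comp {X Y Z : C} (e : Y = Z) (w : Z ⟶ X) :
    (⟨Y, eqToHom e ≫ w⟩ : Σ Y : C, Y ⟶ X) = ⟨Z, w⟩ := by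
  subst e; simp

/-- `X' ×_Γ' Y' ⟶ X ×_Γ Y` for `X' = f^*(X)` and `Y' = f^*(Y)`. -/
noncomputable def fprodMap {Γ' Γ X Y X' Y' : C} (f : Γ' ⟶ Γ) (hX : ObOver X Γ) (hY : ObOver Y Γ)
    (hX' : ObOver X' Γ') (hY' : ObOver Y' Γ') (eX : X' = pull f hX) (eY : Y' = pull f hY) :
    fprod hX' hY' ⟶ fprod hX hY :=
  (isPullback_pull (pTo hX) hY).lift (qTo (pTo hX') hY' ≫ eqToHom eY ≫ qTo f hY)
    (pTo (over_fprod hX' hY') ≫ eqToHom eX ≫ qTo f hX) (by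
      subst eX eY
      have h1 := (isPullback_pull f hX).w
      have h2 := (isPullback_pull f hY).w
      have h3 := (isPullback_pull (pTo hX') hY').w
      simp only [eqToHom_refl, Category.id_comp, Category.assoc, h1, h2]
      rw [← Category.assoc, h3, Category.assoc])

theorem fprodMap_qTo {Γ' Γ X Y X' Y' : C} (f : Γ' ⟶ Γ) (hX : ObOver X Γ) (hY : ObOver Y Γ)
    (hX' : ObOver X' Γ') (hY' : ObOver Y' Γ') (eX : X' = pull f hX) (eY : Y' = pull f hY) :
    fprodMap f hX hY hX' hY' eX eY ≫ qTo (pTo hX) hY =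
      qTo (pTo hX') hY' ≫ eqToHom eY ≫ qTo f hY :=
  (isPullback_pull (pTo hX) hY).lift_fst _ _ _

theorem fprodMap_pTo {Γ' Γ X Y X' Y' : C} (f : Γ' ⟶ Γ) (hX : ObOver X Γ) (hY : ObOver Y Γ)
    (hX' : ObOver X' Γ') (hY' : ObOver Y' Γ') (eX : X' = pull f hX) (eY : Y' = pull f hY) :
    fprodMap f hX hY hX' hY' eX eY ≫ pTo (over_fprod hX hY) =
      pTo (over_fprod hX' hY') ≫ eqToHom eX ≫ qTo f hX :=
  (isPullback_pull (pTo hX) hY).lift_snd _ _ _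

/-- Both objects are base changes of `Y` along one morphism `X' ⟶ Γ`, factored in two ways: as `q(f,
X)` followed by `p(X, Γ)`, and as `p(X', Γ')` followed by `f`. Strict functoriality of base change
makes them equal, and the two maps to `X ×_Γ Y` have the same projections. -/
theorem pullPair_fprod {Γ' Γ X Y X' Y' : C} (f : Γ' ⟶ Γ) (hX : ObOver X Γ) (hY : ObOver Y Γ)
    (hX' : ObOver X' Γ') (hY' : ObOver Y' Γ') (eX : X' = pull f hX) (eY : Y' = pull f hY)
    (h : ObOver (fprod hX hY) Γ) :
    (⟨pull f h, qTo f h⟩ : Σ Z : C, Z ⟶ fprod hX hY) =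
      ⟨fprod hX' hY', fprodMap f hX hY hX' hY' eX eY⟩ := by
  subst eX eY
  have hcomm : qTo f hX ≫ pTo hX = pTo hX' ≫ f := (isPullback_pull f hX).w
  have e1 := pullPair_trans f (over_fprod hX hY) hX h
  have e2 := pull_comp (qTo f hX) (pTo hX) hY
  have e3 := pull_comp (pTo hX') f hY
  have e4 := pull_congr_hom hcomm hY
  have e : fprod hX' hY' = pull (qTo f hX) (over_fprod hX hY) := by
    rw [← e2, e4, e3]
  rw [e1]
  refine Eq.symm ?_
  have key : fprodMap f hX hY hX' hY' rfl rfl =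
      eqToHom e ≫ qTo (qTo f hX) (over_fprod hX hY) := by
    apply (isPullback_pull (pTo hX) hY).hom_ext
    · have h1 := qTo_comp (qTo f hX) (pTo hX) hY
      have h2 := qTo_comp (pTo hX') f hY
      rw [qTo_congr_hom hcomm, h2] at h1
      have h3 : qTo (qTo f hX) (over_fprod hX hY) ≫ qTo (pTo hX) hY =
          eqToHom e.symm ≫ qTo (pTo hX') hY' ≫ qTo f hY := by
        rw [← cancel_epi (eqToHom e2)]
        refine h1.symm.trans ?_
        simp
      refine (fprodMap_qTo _ _ _ _ _ _ _).trans ?_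
      rw [Category.assoc]
      refine Eq.trans ?_ (congrArg (eqToHom e ≫ ·) h3.symm)
      simp
    · refine (fprodMap_pTo _ _ _ _ _ _ _).trans ?_
      have h3 := (isPullback_pull (qTo f hX) (over_fprod hX hY)).w
      rw [Category.assoc]
      refine Eq.trans ?_ (congrArg (eqToHom e ≫ ·) h3.symm)
      rw [← Category.assoc (eqToHom e), eqToHom_comp_pTo e _ (over_fprod hX' hY')]
      simp
  rw [key]
  exact sigma_mk_eqToHom_comp e _

/-- `f^*(a)` is recognized among all morphisms by its two projections. -/
theorem arrow_baseChange_eq_iff {Γ' Γ X Y X' Y' : C} (f : Γ' ⟶ Γ) {hX : ObOver X Γ}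
    {hY : ObOver Y Γ} (a : X ⟶ Y) (ha : IsOver hX hY a) (w : X' ⟶ X)
    (e : (⟨pull f hX, qTo f hX⟩ : Σ Z : C, Z ⟶ X) = ⟨X', w⟩) (e' : Y' = pull f hY)
    (b : X' ⟶ Y') (hX' : ObOver X' Γ') (hY' : ObOver Y' Γ') (hb : IsOver hX' hY' b) :
    Arrow.mk (baseChange f a ha) = Arrow.mk b ↔ b ≫ eqToHom e' ≫ qTo f hY = w ≫ a := by
  subst e'
  have e1 : X' = pull f hX := (congrArg Sigma.fst e).symm
  subst e1
  obtain rfl : w = qTo f hX := by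
    rw [Sigma.mk.injEq] at e
    exact (eq_of_heq e.2).symm
  rw [Arrow.mk_inj, eqToHom_refl, Category.id_comp]
  constructor
  · rintro rfl
    exact baseChange_qTo _ _ _
  · intro h
    apply (isPullback_pull f hY).hom_ext
    · rw [h]; exact baseChange_qTo _ _ _
    · exact Eq.trans (baseChange_pTo f a ha) (Eq.symm hb)

theorem exch_qTo {X Y Γ : C} (hX : ObOver X Γ) (hY : ObOver Y Γ) :
    exch hX hY ≫ qTo (pTo hY) hX = pTo (over_fprod hX hY) :=
  (isPullback_pull (pTo hY) hX).lift_fst _ _ _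

theorem exch_pTo {X Y Γ : C} (hX : ObOver X Γ) (hY : ObOver Y Γ) :
    exch hX hY ≫ pTo (over_fprod hY hX) = qTo (pTo hX) hY :=
  (isPullback_pull (pTo hY) hX).lift_snd _ _ _

theorem exch_exch {X Y Γ : C} (hX : ObOver X Γ) (hY : ObOver Y Γ) :
    exch hX hY ≫ exch hY hX = 𝟙 _ := by
  apply (isPullback_pull (pTo hX) hY).hom_ext
  · rw [Category.assoc, exch_qTo, exch_pTo, Category.id_comp]
  · rw [Category.assoc]
    exact (congrArg _ (exch_pTo hY hX)).trans ((exch_qTo hX hY).trans (Category.id_comp _).symm)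

/-- Naturality of the exchange under base change, which carries stability from one form of `Ap` to
the other. -/
theorem fprodMap_exch {Γ' Γ X Y X' Y' : C} (f : Γ' ⟶ Γ) (hX : ObOver X Γ) (hY : ObOver Y Γ)
    (hX' : ObOver X' Γ') (hY' : ObOver Y' Γ') (eX : X' = pull f hX) (eY : Y' = pull f hY) :
    fprodMap f hX hY hX' hY' eX eY ≫ exch hX hY =
      exch hX' hY' ≫ fprodMap f hY hX hY' hX' eY eX := by
  apply (isPullback_pull (pTo hY) hX).hom_ext
  · rw [Category.assoc, Category.assoc, exch_qTo, fprodMap_qTo, fprodMap_pTo,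
      ← Category.assoc (exch hX' hY'), exch_qTo]
  · rw [Category.assoc, Category.assoc]
    refine (congrArg _ (exch_pTo hX hY)).trans ?_
    refine Eq.trans ?_ (congrArg _ (fprodMap_pTo f hY hX hY' hX' eY eX).symm)
    rw [fprodMap_qTo, ← Category.assoc (exch hX' hY')]
    exact congrArg (· ≫ eqToHom eY ≫ qTo f hY) (exch_pTo hX' hY').symm

/-- The condition `ft(Π(B)) = Γ` alone would allow `Π(B) = pt = Γ`. Stability excludes it: base
change along `p_A` would give `Π(p_A^*(B)) = A`, whose father must be `ft²(p_A^*(B)) = A`, although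
`ft(A)` is shorter than `A`. -/
theorem PiFun.pos (P : PiFun.{v, u} C) (B : ObGE2.{v, u} C) : 0 < l (P.toFun B) := by
  rcases Nat.eq_zero_or_pos (l (P.toFun B)) with h0 | h0
  · exfalso
    have h1 : P.toFun B = B.Γ := by
      rw [← P.ft_toFun B, (l_eq_zero_iff _).1 h0, ft_pt]
    have h2 := P.pull_toFun B (pTo B.A_overΓ)
    rw [pull_self _ h1] at h2
    have h3 := P.ft_toFun (B.pull (pTo B.A_overΓ))
    have h4 := (B.pull (pTo B.A_overΓ)).l_Γ
    have h5 : l (B.pull (pTo B.A_overΓ)).1 = l B.A + (l B.1 - l B.Γ) := l_pull _ B.overΓ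
    have h6 := B.l_A
    have h7 := B.l_Γ
    have h8 := B.2
    rw [← h3, ← h2, l_ft _ (by omega)] at h4
    omega
  · exact h0

/-! ### Presentations of one object as a base change of another, and the induced maps. -/

/-- A presentation of `B'` as `g^*(B)`. -/
structure Cart (B' B : ObGE2.{v, u} C) where
  g : B'.Γ ⟶ B.Γ
  eq : B'.1 = pull g B.overΓ

theorem ObGE2.ft_pull (B : ObGE2.{v, u} C) {Γ' : C} (f : Γ' ⟶ B.Γ) :
    ft (CSystem.pull f B.overΓ) = CSystem.pull f B.A_overΓ :=
  CSystem.ft_pull f B.overΓ (by have := B.l_Γ; have := B.2; omega)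

theorem ObGE2.pull_Γ (B : ObGE2.{v, u} C) {Γ' : C} (f : Γ' ⟶ B.Γ) : (B.pull f).Γ = Γ' :=
  (B.toObN.pull f).ft_obj

namespace Cart

variable {B B' B'' : ObGE2.{v, u} C}

theorem eq_pull (c : Cart B' B) : B' = B.pull c.g := Subtype.ext c.eq

theorem eq_A (c : Cart B' B) : B'.A = pull c.g B.A_overΓ :=
  (congrArg ft c.eq).trans (B.ft_pull c.g)

theorem eq_Pi (c : Cart B' B) (P : PiFun.{v, u} C) : P.toFun B' = pull c.g (P.over B) :=
  (congrArg P.toFun c.eq_pull).trans (P.pull_toFun B c.g).symm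

/-- `B' ⟶ B`. -/
def qB (c : Cart B' B) : B'.1 ⟶ B.1 := eqToHom c.eq ≫ qTo c.g B.overΓ

/-- `ft(B') ⟶ ft(B)`. -/
def qA (c : Cart B' B) : B'.A ⟶ B.A := eqToHom c.eq_A ≫ qTo c.g B.A_overΓ

/-- `Π(B') ⟶ Π(B)`. -/
def qPi (c : Cart B' B) (P : PiFun.{v, u} C) : P.toFun B' ⟶ P.toFun B :=
  eqToHom (c.eq_Pi P) ≫ qTo c.g (P.over B)

theorem isPullback_A (c : Cart B' B) :
    IsPullback c.qA (pTo B'.A_overΓ) (pTo B.A_overΓ) c.g := by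
  simpa [qA] using isPullback_of_eq c.g B.A_overΓ rfl c.eq_A B'.A_overΓ

theorem isPullback_Pi (c : Cart B' B) (P : PiFun.{v, u} C) :
    IsPullback (c.qPi P) (pTo (P.over B')) (pTo (P.over B)) c.g := by
  simpa [qPi] using isPullback_of_eq c.g (P.over B) rfl (c.eq_Pi P) (P.over B')

theorem isPullback_B (c : Cart B' B) :
    IsPullback c.qB (pTo B'.overΓ) (pTo B.overΓ) c.g := by
  simpa [qB] using isPullback_of_eq c.g B.overΓ rfl c.eq B'.overΓ

theorem qB_p (c : Cart B' B) : c.qB ≫ p B.1 rfl = p B'.1 rfl ≫ c.qA := by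
  have h := qTo_comp_p c.g B.overΓ (by have := B.l_Γ; have := B.2; omega)
  have aux : ∀ {X Y : C} (e : X = Y) {Z : C} (e' : ft Y = Z) (e'' : ft X = Z),
      eqToHom e ≫ p Y e' = p X rfl ≫ eqToHom e'' := by
    intro X Y e Z e' e''; subst e; subst e'; simp
  have h' := aux c.eq (B.ft_pull c.g) c.eq_A
  rw [qB, qA, Category.assoc, h, ← Category.assoc, h', Category.assoc]

/-- Composition of base changes. -/
def comp (c' : Cart B'' B') (c : Cart B' B) : Cart B'' B where
  g := c'.g ≫ c.g
  eq := by
    have aux : ∀ {X : C} (_ : X = pull c.g B.overΓ) (h : ObOver X B'.Γ),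
        pull c'.g h = pull c'.g (over_pull c.g B.overΓ) := by
      intro X e h; subst e; rfl
    rw [pull_comp, c'.eq, aux c.eq]

theorem comp_qA (c' : Cart B'' B') (c : Cart B' B) : (c'.comp c).qA = c'.qA ≫ c.qA :=
  eqToHom_qTo_comp c'.g c.g B.A_overΓ B'.A_overΓ c.eq_A c'.eq_A _

theorem comp_qB (c' : Cart B'' B') (c : Cart B' B) : (c'.comp c).qB = c'.qB ≫ c.qB :=
  eqToHom_qTo_comp c'.g c.g B.overΓ B'.overΓ c.eq c'.eq _

theorem comp_qPi (c' : Cart B'' B') (c : Cart B' B) (P : PiFun.{v, u} C) :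
    (c'.comp c).qPi P = c'.qPi P ≫ c.qPi P :=
  eqToHom_qTo_comp c'.g c.g (P.over B) (P.over B') (c.eq_Pi P) (c'.eq_Pi P) _

@[ext]
theorem ext {c c' : Cart B' B} (h : c.g = c'.g) : c = c' := by
  cases c; cases c'; cases h; rfl

theorem qA_of_id (c : Cart B B) (h : c.g = 𝟙 _) : c.qA = 𝟙 _ := eqToHom_qTo_id h _ _

theorem qB_of_id (c : Cart B B) (h : c.g = 𝟙 _) : c.qB = 𝟙 _ := eqToHom_qTo_id h _ _

theorem qPi_of_id (c : Cart B B) (h : c.g = 𝟙 _) (P : PiFun.{v, u} C) : c.qPi P = 𝟙 _ :=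
  eqToHom_qTo_id h _ _

/-- The base change of `B` along `f : Γ' ⟶ Γ`. -/
def ofHom (B : ObGE2.{v, u} C) {Γ' : C} (f : Γ' ⟶ B.Γ) : Cart (B.pull f) B where
  -- The base `ft²` of `B.pull f` equals `Γ'` only propositionally, hence the cast before `f`.
  -- Generalizing that base to a variable `Δ` lets the equality be substituted.
  g := eqToHom (B.pull_Γ f) ≫ f
  eq := by
    have aux : ∀ {Δ : C} (e : Δ = Γ'), pull f B.overΓ = pull (eqToHom e ≫ f) B.overΓ := by
      intro Δ e; subst e; simp
    exact aux _

theorem ofHom_qB (B : ObGE2.{v, u} C) {Γ' : C} (f : Γ' ⟶ B.Γ) :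
    (ofHom B f).qB = qTo f B.overΓ := by
  have aux : ∀ {Δ : C} (e : Δ = Γ') (e' : pull f B.overΓ = pull (eqToHom e ≫ f) B.overΓ),
      eqToHom e' ≫ qTo (eqToHom e ≫ f) B.overΓ = qTo f B.overΓ := by
    intro Δ e e'; subst e
    exact (eqToHom_qTo_congr (Category.id_comp f) B.overΓ e' rfl).trans (by simp)
  exact aux _ _

theorem ofHom_qA (B : ObGE2.{v, u} C) {Γ' : C} (f : Γ' ⟶ B.Γ) :
    (ofHom B f).qA = eqToHom (B.ft_pull f) ≫ qTo f B.A_overΓ := by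
  have aux : ∀ {Δ X : C} (e : Δ = Γ') (e' : X = pull (eqToHom e ≫ f) B.A_overΓ)
      (e'' : X = pull f B.A_overΓ), eqToHom e' ≫ qTo (eqToHom e ≫ f) B.A_overΓ =
        eqToHom e'' ≫ qTo f B.A_overΓ := by
    intro Δ X e e' e''; subst e
    exact eqToHom_qTo_congr (Category.id_comp f) _ _ _
  exact aux _ _ _

theorem ofHom_qPi (B : ObGE2.{v, u} C) {Γ' : C} (f : Γ' ⟶ B.Γ) (P : PiFun.{v, u} C) :
    (ofHom B f).qPi P = eqToHom (P.pull_toFun B f).symm ≫ qTo f (P.over B) := by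
  have aux : ∀ {Δ X : C} (e : Δ = Γ') (e' : X = pull (eqToHom e ≫ f) (P.over B))
      (e'' : X = pull f (P.over B)), eqToHom e' ≫ qTo (eqToHom e ≫ f) (P.over B) =
        eqToHom e'' ≫ qTo f (P.over B) := by
    intro Δ X e e' e''; subst e
    exact eqToHom_qTo_congr (Category.id_comp f) _ _ _
  exact aux _ _ _

/-- `A' ×_Γ' Π(B') ⟶ A ×_Γ Π(B)`. -/
noncomputable def prod1Map (c : Cart B' B) (P : PiFun.{v, u} C) : P.prod1 B' ⟶ P.prod1 B :=
  fprodMap c.g B.A_overΓ (P.over B) B'.A_overΓ (P.over B') c.eq_A (c.eq_Pi P)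

/-- `Π(B') ×_Γ' A' ⟶ Π(B) ×_Γ A`. -/
noncomputable def prod2Map (c : Cart B' B) (P : PiFun.{v, u} C) : P.prod2 B' ⟶ P.prod2 B :=
  fprodMap c.g (P.over B) B.A_overΓ (P.over B') B'.A_overΓ (c.eq_Pi P) c.eq_A

theorem prod2Map_qTo (c : Cart B' B) (P : PiFun.{v, u} C) :
    c.prod2Map P ≫ qTo (pTo (P.over B)) B.A_overΓ =
      qTo (pTo (P.over B')) B'.A_overΓ ≫ c.qA :=
  fprodMap_qTo _ _ _ _ _ _ _

theorem prod2Map_pTo (c : Cart B' B) (P : PiFun.{v, u} C) :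
    c.prod2Map P ≫ pTo (over_fprod (P.over B) B.A_overΓ) =
      pTo (over_fprod (P.over B') B'.A_overΓ) ≫ c.qPi P :=
  fprodMap_pTo _ _ _ _ _ _ _

theorem prod1Map_exch (c : Cart B' B) (P : PiFun.{v, u} C) :
    c.prod1Map P ≫ exch B.A_overΓ (P.over B) =
      exch B'.A_overΓ (P.over B') ≫ c.prod2Map P :=
  fprodMap_exch _ _ _ _ _ _ _

end Cart

/-- Stability of a family of morphisms over `Γ` with codomains `B`, tested on all presentations
of objects as base changes. -/
theorem stable_iff (D : ObGE2.{v, u} C → C) (hD : ∀ B, ObOver (D B) B.Γ)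
    (w : ∀ {B' B : ObGE2.{v, u} C}, Cart B' B → (D B' ⟶ D B))
    (hw : ∀ {B' B : ObGE2.{v, u} C} (c : Cart B' B),
      (⟨pull c.g (hD B), qTo c.g (hD B)⟩ : Σ Z : C, Z ⟶ D B) = ⟨D B', w c⟩)
    (a : ∀ B, D B ⟶ B.1) (ha : ∀ B, IsOver (hD B) B.overΓ (a B)) :
    (∀ (B : ObGE2.{v, u} C) {Γ' : C} (f : Γ' ⟶ B.Γ),
      Arrow.mk (baseChange f (a B) (ha B)) = Arrow.mk (a (B.pull f))) ↔
      ∀ {B' B : ObGE2.{v, u} C} (c : Cart B' B), a B' ≫ c.qB = w c ≫ a B := by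
  have key : ∀ {B' B : ObGE2.{v, u} C} (c : Cart B' B),
      Arrow.mk (baseChange c.g (a B) (ha B)) = Arrow.mk (a B') ↔ a B' ≫ c.qB = w c ≫ a B :=
    fun {B' B} c => arrow_baseChange_eq_iff c.g (a B) (ha B) (w c) (hw c) c.eq (a B') (hD B')
      B'.overΓ (ha B')
  constructor
  · intro h B' B c
    rw [← key, h]
    exact congrArg (fun X => Arrow.mk (a X)) c.eq_pull.symm
  · intro h B Γ' f
    -- Base change along `f` is the presentation `Cart.ofHom B f`, up to the cast that `aux`
    -- removes.
    have h1 := (key (Cart.ofHom B f)).2 (h _)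
    rw [← h1]
    have aux : ∀ {Δ : C} (e : Δ = Γ'), Arrow.mk (baseChange f (a B) (ha B)) =
        Arrow.mk (baseChange (eqToHom e ≫ f) (a B) (ha B)) := by
      intro Δ e; subst e
      exact congrArg (fun g : Δ ⟶ B.Γ => Arrow.mk (baseChange g (a B) (ha B)))
        (Category.id_comp f).symm
    exact aux _

theorem stable_iff_prod2 (P : PiFun.{v, u} C) (a : ∀ B, P.prod2 B ⟶ B.1)
    (ha : ∀ B, IsOver (P.prod2_overΓ B) B.overΓ (a B)) :
    (∀ (B : ObGE2.{v, u} C) {Γ' : C} (f : Γ' ⟶ B.Γ),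
      Arrow.mk (baseChange f (a B) (ha B)) = Arrow.mk (a (B.pull f))) ↔
      ∀ {B' B : ObGE2.{v, u} C} (c : Cart B' B), a B' ≫ c.qB = c.prod2Map P ≫ a B :=
  stable_iff P.prod2 P.prod2_overΓ (fun c => c.prod2Map P)
    (fun _ => pullPair_fprod _ _ _ _ _ _ _ _) a ha

theorem stable_iff_prod1 (P : PiFun.{v, u} C) (a : ∀ B, P.prod1 B ⟶ B.1)
    (ha : ∀ B, IsOver (P.prod1_overΓ B) B.overΓ (a B)) :
    (∀ (B : ObGE2.{v, u} C) {Γ' : C} (f : Γ' ⟶ B.Γ),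
      Arrow.mk (baseChange f (a B) (ha B)) = Arrow.mk (a (B.pull f))) ↔
      ∀ {B' B : ObGE2.{v, u} C} (c : Cart B' B), a B' ≫ c.qB = c.prod1Map P ≫ a B :=
  stable_iff P.prod1 P.prod1_overΓ (fun c => c.prod1Map P)
    (fun _ => pullPair_fprod _ _ _ _ _ _ _ _) a ha

/-! ### Sections over `Γ` and base change of sections -/

/-- A section of `p_{Π(B)}` as a morphism `Γ ⟶ Π(B)`. -/
def Sections.toHom {P : PiFun.{v, u} C} {B : ObGE2.{v, u} C} (t : Sections (P.toFun B)) :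
    B.Γ ⟶ P.toFun B := eqToHom (P.ft_toFun B).symm ≫ t.hom

theorem Sections.toHom_pTo {P : PiFun.{v, u} C} {B : ObGE2.{v, u} C}
    (t : Sections (P.toFun B)) : t.toHom ≫ pTo (P.over B) = 𝟙 _ := by
  rw [Sections.toHom, Category.assoc, t.comp_pTo, eqToHom_trans, eqToHom_refl]

theorem Sections.toHom_injective {P : PiFun.{v, u} C} {B : ObGE2.{v, u} C}
    {t t' : Sections (P.toFun B)} (h : t.toHom = t'.toHom) : t = t' :=
  Sections.ext ((cancel_epi _).1 h)

/-- The section of `p_{Π(B)}` with a given underlying morphism `Γ ⟶ Π(B)`. -/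
def PiFun.mkSection (P : PiFun.{v, u} C) {B : ObGE2.{v, u} C} (m : B.Γ ⟶ P.toFun B)
    (hm : m ≫ pTo (P.over B) = 𝟙 _) : Sections (P.toFun B) where
  hom := eqToHom (P.ft_toFun B) ≫ m
  hom_p := by
    rw [pTo_of_ft (P.ft_toFun B) (P.pos B)] at hm
    rw [Category.assoc, comp_p_of_eq (P.ft_toFun B), hm]
    simp
  pos := P.pos B

theorem PiFun.mkSection_toHom (P : PiFun.{v, u} C) {B : ObGE2.{v, u} C} (m : B.Γ ⟶ P.toFun B)
    (hm : m ≫ pTo (P.over B) = 𝟙 _) : (P.mkSection m hm).toHom = m := by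
  simp [Sections.toHom, PiFun.mkSection]

namespace Cart

variable {B B' B'' : ObGE2.{v, u} C}

/-- `o'` is the base change of the section `o` of `p_B`. -/
def SecRel (c : Cart B' B) (o : Sections B.1) (o' : Sections B'.1) : Prop :=
  o'.hom ≫ c.qB = c.qA ≫ o.hom

/-- `t'` is the base change of the section `t` of `p_{Π(B)}`. -/
def PiRel (c : Cart B' B) (P : PiFun.{v, u} C) (t : Sections (P.toFun B))
    (t' : Sections (P.toFun B')) : Prop :=
  t'.toHom ≫ c.qPi P = c.g ≫ t.toHom

/-- With `exists_piRel`, and likewise for `SecRel`, this makes the relation the graph of a function,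
by the two halves of the pullback property. The relations stand in for pulled back sections without
casts. -/
theorem PiRel.unique {c : Cart B' B} {P : PiFun.{v, u} C} {t : Sections (P.toFun B)}
    {t₁ t₂ : Sections (P.toFun B')} (h₁ : c.PiRel P t t₁) (h₂ : c.PiRel P t t₂) : t₁ = t₂ :=
  Sections.toHom_injective ((c.isPullback_Pi P).hom_ext (Eq.trans h₁ (Eq.symm h₂))
    (t₁.toHom_pTo.trans t₂.toHom_pTo.symm))

theorem exists_piRel (c : Cart B' B) (P : PiFun.{v, u} C) (t : Sections (P.toFun B)) :
    ∃ t', c.PiRel P t t' := by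
  have h : (c.g ≫ t.toHom) ≫ pTo (P.over B) = 𝟙 _ ≫ c.g := by
    rw [Category.assoc, t.toHom_pTo, Category.comp_id, Category.id_comp]
  refine ⟨P.mkSection ((c.isPullback_Pi P).lift _ _ h) ((c.isPullback_Pi P).lift_snd _ _ _), ?_⟩
  unfold PiRel
  rw [PiFun.mkSection_toHom]
  exact (c.isPullback_Pi P).lift_fst _ _ _

theorem pTo_overΓ (B : ObGE2.{v, u} C) : pTo B.overΓ = p B.1 rfl ≫ pTo B.A_overΓ := by
  rw [pTo_trans B.overA B.A_overΓ, pTo_of_ft rfl (by have := B.2; omega) B.overA]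

theorem SecRel.unique {c : Cart B' B} {o : Sections B.1}
    {o₁ o₂ : Sections B'.1} (h₁ : c.SecRel o o₁) (h₂ : c.SecRel o o₂) : o₁ = o₂ := by
  apply Sections.ext
  apply c.isPullback_B.hom_ext (Eq.trans h₁ (Eq.symm h₂))
  rw [pTo_overΓ, ← Category.assoc, ← Category.assoc, o₁.hom_p, o₂.hom_p]

theorem exists_secRel (c : Cart B' B) (o : Sections B.1) : ∃ o', c.SecRel o o' := by
  have h : (c.qA ≫ o.hom) ≫ pTo B.overΓ = pTo B'.A_overΓ ≫ c.g := by
    rw [pTo_overΓ, Category.assoc, ← Category.assoc o.hom, o.hom_p, Category.id_comp,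
      c.isPullback_A.w]
  refine ⟨⟨c.isPullback_B.lift _ _ h, ?_, by have := B'.2; omega⟩, c.isPullback_B.lift_fst _ _ _⟩
  -- That the lift is a section of `p_{B'}` is an equality of endomorphisms of `A'`, tested on the
  -- two legs of the pullback square of `A'`.
  apply c.isPullback_A.hom_ext
  · rw [Category.assoc, ← c.qB_p, ← Category.assoc, c.isPullback_B.lift_fst, Category.assoc,
      o.hom_p]
    exact (Category.comp_id _).trans (Category.id_comp _).symm
  · rw [Category.assoc, ← pTo_overΓ, c.isPullback_B.lift_snd]
    exact (Category.id_comp _).symm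

end Cart

/-- The graph `A ⟶ Π(B) ×_Γ A` of a section of `p_{Π(B)}`. -/
noncomputable def graph {P : PiFun.{v, u} C} {B : ObGE2.{v, u} C} (t : Sections (P.toFun B)) :
    B.A ⟶ P.prod2 B :=
  (isPullback_pull (pTo (P.over B)) B.A_overΓ).lift (𝟙 _) (pTo B.A_overΓ ≫ t.toHom) (by
    rw [Category.assoc, t.toHom_pTo, Category.comp_id, Category.id_comp])

theorem graph_qTo {P : PiFun.{v, u} C} {B : ObGE2.{v, u} C} (t : Sections (P.toFun B)) :
    graph t ≫ qTo (pTo (P.over B)) B.A_overΓ = 𝟙 _ :=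
  (isPullback_pull (pTo (P.over B)) B.A_overΓ).lift_fst _ _ _

theorem graph_pTo {P : PiFun.{v, u} C} {B : ObGE2.{v, u} C} (t : Sections (P.toFun B)) :
    graph t ≫ pTo (over_fprod (P.over B) B.A_overΓ) = pTo B.A_overΓ ≫ t.toHom :=
  (isPullback_pull (pTo (P.over B)) B.A_overΓ).lift_snd _ _ _

theorem graph_prod2Map {P : PiFun.{v, u} C} {B B' : ObGE2.{v, u} C} (c : Cart B' B)
    {t : Sections (P.toFun B)} {t' : Sections (P.toFun B')} (h : c.PiRel P t t') :
    graph t' ≫ c.prod2Map P = c.qA ≫ graph t := by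
  apply (isPullback_pull (pTo (P.over B)) B.A_overΓ).hom_ext
  · rw [Category.assoc, Category.assoc, c.prod2Map_qTo, graph_qTo, ← Category.assoc, graph_qTo,
      Category.id_comp, Category.comp_id]
  · refine (Category.assoc _ _ _).trans (Eq.trans ?_ (Category.assoc _ _ _).symm)
    refine (congrArg (graph t' ≫ ·) (c.prod2Map_pTo P)).trans
      (Eq.trans ?_ (congrArg (c.qA ≫ ·) (graph_pTo t).symm))
    refine (Category.assoc _ _ _).symm.trans ((congrArg (· ≫ c.qPi P) (graph_pTo t')).trans ?_)
    rw [Category.assoc, show t'.toHom ≫ c.qPi P = c.g ≫ t.toHom from h, ← Category.assoc,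
      ← c.isPullback_A.w, Category.assoc]

/-- Once `t^*(Π(B) ×_Γ A)` is identified with `A`, the morphism `q(t, Π(B) ×_Γ A)` has the
projections of the graph: the identity on `A`, and `p_A` followed by `t`. This form of `λinv` is
free of casts. -/
theorem lamInv2_hom (P : PiFun.{v, u} C) (B : ObGE2.{v, u} C) (a : P.prod2 B ⟶ B.1)
    (ha : a ≫ p B.1 rfl = qTo (pTo (P.over B)) B.A_overΓ) (t : Sections (P.toFun B)) :
    (lamInv2 P B a ha t).hom = graph t ≫ a := by
  have h : eqToHom (pull_prod2 t).symm ≫ qTo t.hom (over_fprod (P.over B) B.A_overΓ) = graph t := by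
    apply (isPullback_pull (pTo (P.over B)) B.A_overΓ).hom_ext
    · have h := qTo_comp t.hom (pTo (P.over B)) B.A_overΓ
      rw [qTo_congr_hom t.comp_pTo, qTo_eqToHom, eqToHom_trans] at h
      rw [graph_qTo, Category.assoc]
      have h2 : qTo t.hom (over_fprod (P.over B) B.A_overΓ) ≫ qTo (pTo (P.over B)) B.A_overΓ =
          eqToHom (pull_prod2 t) := by
        rw [← cancel_epi (eqToHom (pull_comp t.hom (pTo (P.over B)) B.A_overΓ))]
        exact h.symm.trans (eqToHom_trans _ _).symm
      exact (congrArg _ h2).trans ((eqToHom_trans _ _).trans (eqToHom_refl _ _))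
    · refine Eq.trans ?_ (graph_pTo t).symm
      have h3 := (isPullback_pull t.hom (over_fprod (P.over B) B.A_overΓ)).w
      refine (Category.assoc _ _ _).trans ((congrArg _ h3).trans ?_)
      have aux : ∀ {Γ Γ' X Y : C} (e : X = Y) (e' : Γ = Γ') (h : ObOver Y Γ) (h' : ObOver X Γ'),
          eqToHom e ≫ pTo h = pTo h' ≫ eqToHom e'.symm := by
        intro Γ Γ' X Y e e' h h'; subst e e'; simp
      rw [← Category.assoc, aux _ (P.ft_toFun B) _ B.A_overΓ, Category.assoc]
      rfl
  exact (Category.assoc _ _ _).symm.trans (congrArg (· ≫ a) h)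

theorem lamInv2_secRel (P : PiFun.{v, u} C) (a : ∀ B, P.prod2 B ⟶ B.1)
    (ha : ∀ B, a B ≫ p B.1 rfl = qTo (pTo (P.over B)) B.A_overΓ)
    (hs : ∀ {B' B : ObGE2.{v, u} C} (c : Cart B' B), a B' ≫ c.qB = c.prod2Map P ≫ a B)
    {B B' : ObGE2.{v, u} C} (c : Cart B' B)
    {t : Sections (P.toFun B)} {t' : Sections (P.toFun B')} (h : c.PiRel P t t') :
    c.SecRel (lamInv2 P B (a B) (ha B) t) (lamInv2 P B' (a B') (ha B') t') := by
  unfold Cart.SecRel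
  rw [lamInv2_hom, lamInv2_hom, Category.assoc, hs c, ← Category.assoc, graph_prod2Map c h,
    Category.assoc]

/-! ### Natural families of bijections and evaluation morphisms -/

/-- Families of bijections between sections of `p_B` and of `p_{Π(B)}` that are stable under
base change. -/
@[ext]
structure NatLam (P : PiFun.{v, u} C) where
  lam : ∀ B : ObGE2.{v, u} C, Sections B.1 → Sections (P.toFun B)
  bij : ∀ B, Function.Bijective (lam B)
  natural : ∀ {B' B : ObGE2.{v, u} C} (c : Cart B' B) (o : Sections B.1) (o' : Sections B'.1),
    c.SecRel o o' → c.PiRel P (lam B o) (lam B' o')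

namespace PiFun

variable (P : PiFun.{v, u} C) (B : ObGE2.{v, u} C)

/-- `Π(B) ×_Γ B`. -/
abbrev gen : ObGE2.{v, u} C := B.pull (pTo (P.over B))

/-- `Π(B) ×_Γ B` as a base change of `B`. -/
abbrev genCart : Cart (P.gen B) B := Cart.ofHom B (pTo (P.over B))

theorem gen_Γ : (P.gen B).Γ = P.toFun B := B.pull_Γ _

theorem gen_A : (P.gen B).A = P.prod2 B := B.ft_pull _

theorem genCart_qA : (P.genCart B).qA =
    eqToHom (P.gen_A B) ≫ qTo (pTo (P.over B)) B.A_overΓ := Cart.ofHom_qA _ _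

theorem genCart_g : (P.genCart B).g = eqToHom (P.gen_Γ B) ≫ pTo (P.over B) := rfl

/-- The diagonal section of `p` at `Π(B) ×_Γ Π(B)`. -/
noncomputable def diagSection : Sections (P.toFun (P.gen B)) :=
  P.mkSection (((P.genCart B).isPullback_Pi P).lift (eqToHom (P.gen_Γ B)) (𝟙 _)
    (by rw [genCart_g, Category.id_comp])) (((P.genCart B).isPullback_Pi P).lift_snd _ _ _)

theorem diagSection_qPi : (P.diagSection B).toHom ≫ (P.genCart B).qPi P = eqToHom (P.gen_Γ B) := by
  rw [diagSection, mkSection_toHom]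
  exact ((P.genCart B).isPullback_Pi P).lift_fst _ _ _

theorem gen_pTo : pTo (P.gen B).A_overΓ =
    eqToHom (P.gen_A B) ≫ pTo (over_fprod (P.over B) B.A_overΓ) ≫ eqToHom (P.gen_Γ B).symm := by
  have aux : ∀ {Γ Γ' X Y : C} (e : X = Y) (e' : Γ = Γ') (h : ObOver Y Γ') (h' : ObOver X Γ),
      pTo h' = eqToHom e ≫ pTo h ≫ eqToHom e'.symm := by
    intro Γ Γ' X Y e e' h h'; subst e e'; simp
  exact aux (P.gen_A B) (P.gen_Γ B) _ _

variable {B}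

/-- `Π(B') ×_Γ' B'` as a base change of `Π(B) ×_Γ B`. -/
def genMap {B' : ObGE2.{v, u} C} (c : Cart B' B) : Cart (P.gen B') (P.gen B) where
  -- The map `Π(B') ⟶ Π(B)`, with casts because the bases of the generic objects are these objects
  -- only propositionally.
  g := eqToHom (P.gen_Γ B') ≫ c.qPi P ≫ eqToHom (P.gen_Γ B).symm
  eq := by
    have h1 := ((P.genCart B').comp c).eq
    have h2 : ((P.genCart B').comp c).g =
        (eqToHom (P.gen_Γ B') ≫ c.qPi P ≫ eqToHom (P.gen_Γ B).symm) ≫ (P.genCart B).g := by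
      change (eqToHom _ ≫ pTo (P.over B')) ≫ c.g = _
      rw [genCart_g, Category.assoc, ← (c.isPullback_Pi P).w]
      simp
    rw [h1, pull_congr_hom h2, pull_comp]
    have aux : ∀ {X : C} (_ : X = pull (P.genCart B).g B.overΓ) (h : ObOver X (P.gen B).Γ)
        (h' : ObOver (pull (P.genCart B).g B.overΓ) (P.gen B).Γ),
        ∀ {Δ : C} (g : Δ ⟶ (P.gen B).Γ), pull g h' = pull g h := by
      intro X e h h' Δ g; subst e; rfl
    exact aux (P.genCart B).eq _ _ _

/-- A presentation is determined by its base map, so this is the square of `Π(B') ⟶ Π(B)` over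
`c.g`. -/
theorem genMap_comp {B' : ObGE2.{v, u} C} (c : Cart B' B) :
    (P.genMap c).comp (P.genCart B) = (P.genCart B').comp c := by
  apply Cart.ext
  change (eqToHom (P.gen_Γ B') ≫ c.qPi P ≫ eqToHom (P.gen_Γ B).symm) ≫
    eqToHom _ ≫ pTo (P.over B) = (eqToHom _ ≫ pTo (P.over B')) ≫ c.g
  rw [Category.assoc (eqToHom _) (pTo _), ← (c.isPullback_Pi P).w]
  simp

theorem genMap_qA {B' : ObGE2.{v, u} C} (c : Cart B' B) :
    (P.genMap c).qA ≫ eqToHom (P.gen_A B) = eqToHom (P.gen_A B') ≫ c.prod2Map P := by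
  apply (isPullback_pull (pTo (P.over B)) B.A_overΓ).hom_ext
  · rw [Category.assoc, Category.assoc, ← genCart_qA, ← Cart.comp_qA, genMap_comp, Cart.comp_qA,
      c.prod2Map_qTo, genCart_qA, Category.assoc]
  · have h1 := (P.genMap c).isPullback_A.w
    rw [gen_pTo, gen_pTo] at h1
    have h2 := congrArg (· ≫ eqToHom (P.gen_Γ B)) h1
    dsimp only [genMap] at h2
    simp only [Category.assoc, eqToHom_trans, eqToHom_trans_assoc, eqToHom_refl, Category.id_comp,
      Category.comp_id] at h2
    refine (Category.assoc _ _ _).trans (Eq.trans ?_ (Category.assoc _ _ _).symm)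
    exact h2.trans (congrArg _ (c.prod2Map_pTo P).symm)

/-- Followed by either projection of `Π(B) ×_Γ Π(B)`, both sides become the map `Π(B') ⟶ Π(B)`, up
to casts. -/
theorem diagSection_rel {B' : ObGE2.{v, u} C} (c : Cart B' B) :
    (P.genMap c).PiRel P (P.diagSection B) (P.diagSection B') := by
  unfold Cart.PiRel
  apply ((P.genCart B).isPullback_Pi P).hom_ext
  · rw [Category.assoc, ← Cart.comp_qPi, genMap_comp, Cart.comp_qPi, ← Category.assoc,
      diagSection_qPi, Category.assoc, diagSection_qPi]
    simp [genMap]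
  · rw [Category.assoc, ((P.genMap c).isPullback_Pi P).w, ← Category.assoc, Sections.toHom_pTo,
      Category.assoc, Sections.toHom_pTo, Category.id_comp, Category.comp_id]

/-- `B` as the base change of `Π(B) ×_Γ B` along a section of `p_{Π(B)}`. -/
def sectionCart (t : Sections (P.toFun B)) : Cart B (P.gen B) where
  g := t.toHom ≫ eqToHom (P.gen_Γ B).symm
  eq := by
    -- Since `t` is a section of `p_{Π(B)}`, pulling `B` back along `p_{Π(B)}` and then along `t` is
    -- pulling it back along the identity.
    have h2 : (t.toHom ≫ eqToHom (P.gen_Γ B).symm) ≫ (P.genCart B).g = 𝟙 _ := by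
      rw [genCart_g, Category.assoc]
      simpa using t.toHom_pTo
    have h3 := pull_id B.overΓ
    rw [← pull_congr_hom h2, pull_comp] at h3
    have aux : ∀ {X : C} (_ : X = pull (P.genCart B).g B.overΓ) (h : ObOver X (P.gen B).Γ)
        (h' : ObOver (pull (P.genCart B).g B.overΓ) (P.gen B).Γ),
        ∀ {Δ : C} (g : Δ ⟶ (P.gen B).Γ), pull g h' = pull g h := by
      intro X e h h' Δ g; subst e; rfl
    exact h3.symm.trans (aux (P.genCart B).eq _ _ _)

theorem sectionCart_comp_g (t : Sections (P.toFun B)) :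
    ((P.sectionCart t).comp (P.genCart B)).g = 𝟙 _ := by
  change (t.toHom ≫ eqToHom (P.gen_Γ B).symm) ≫ eqToHom _ ≫ pTo (P.over B) = _
  rw [Category.assoc]
  simpa using t.toHom_pTo

/-- Universality of the diagonal: both projections of its restriction along `t` are `t`. -/
theorem sectionCart_rel (t : Sections (P.toFun B)) :
    (P.sectionCart t).PiRel P (P.diagSection B) t := by
  unfold Cart.PiRel
  apply ((P.genCart B).isPullback_Pi P).hom_ext
  · rw [Category.assoc, ← Cart.comp_qPi, Cart.qPi_of_id _ (P.sectionCart_comp_g t),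
      Category.assoc, diagSection_qPi]
    simp [sectionCart]
  · rw [Category.assoc, ((P.sectionCart t).isPullback_Pi P).w, ← Category.assoc,
      Sections.toHom_pTo, Category.assoc, Sections.toHom_pTo, Category.id_comp, Category.comp_id]

theorem sectionCart_qA (t : Sections (P.toFun B)) :
    (P.sectionCart t).qA ≫ eqToHom (P.gen_A B) = graph t := by
  apply (isPullback_pull (pTo (P.over B)) B.A_overΓ).hom_ext
  · rw [Category.assoc, ← genCart_qA, ← Cart.comp_qA, Cart.qA_of_id _ (P.sectionCart_comp_g t),
      graph_qTo]
  · have h1 := (P.sectionCart t).isPullback_A.w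
    rw [gen_pTo] at h1
    have h2 := congrArg (· ≫ eqToHom (P.gen_Γ B)) h1
    dsimp only [sectionCart] at h2
    simp only [Category.assoc, eqToHom_trans, eqToHom_refl, Category.comp_id] at h2
    exact (Category.assoc _ _ _).trans (h2.trans (graph_pTo t).symm)

/-- The projection to `A` is unchanged by passing to the graph, and the one to `Π(B)` comes from the
diagonal followed by a projection, which is the identity. This is how `Ap` is recovered from `λinv`.
-/
theorem graph_diagSection : eqToHom (P.gen_A B).symm ≫ graph (P.diagSection B) ≫
    (P.genCart B).prod2Map P = 𝟙 _ := by
  apply (isPullback_pull (pTo (P.over B)) B.A_overΓ).hom_ext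
  · rw [Category.assoc, Category.assoc, Cart.prod2Map_qTo, ← Category.assoc (graph _), graph_qTo,
      Category.id_comp, genCart_qA]
    simp
  · refine (Category.assoc _ _ _).trans ?_
    refine (congrArg _ (Category.assoc _ _ _)).trans ?_
    refine (congrArg (fun x => _ ≫ _ ≫ x) ((P.genCart B).prod2Map_pTo P)).trans ?_
    refine (congrArg _ (Category.assoc _ _ _)).symm.trans ?_
    refine (congrArg (fun x => _ ≫ x ≫ _) (graph_pTo _)).trans ?_
    rw [Category.assoc (pTo _), diagSection_qPi, gen_pTo]
    simp

end PiFun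

namespace NatLam

variable {P : PiFun.{v, u} C} (L : NatLam P)

/-- The section that corresponds to the diagonal. -/
noncomputable def ap (B : ObGE2.{v, u} C) : Sections (P.gen B).1 :=
  ((L.bij (P.gen B)).2 (P.diagSection B)).choose

theorem lam_ap (B : ObGE2.{v, u} C) : L.lam _ (L.ap B) = P.diagSection B :=
  ((L.bij (P.gen B)).2 (P.diagSection B)).choose_spec

/-- Naturality can be read backwards because `λ_{B'}` is injective: `λ` of `o'` and `λ` of the base
change of `o` are both the base change of `λ(o)`, hence equal. -/
theorem secRel_of_piRel {B B' : ObGE2.{v, u} C} (c : Cart B' B) {o : Sections B.1}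
    {o' : Sections B'.1} (h : c.PiRel P (L.lam B o) (L.lam B' o')) : c.SecRel o o' := by
  obtain ⟨o₁, h₁⟩ := c.exists_secRel o
  have h₂ := Cart.PiRel.unique h (L.natural c o o₁ h₁)
  rwa [(L.bij B').1 h₂]

/-- The evaluation morphism `Π(B) ×_Γ A ⟶ B`. -/
noncomputable def eval (B : ObGE2.{v, u} C) : P.prod2 B ⟶ B.1 :=
  eqToHom (P.gen_A B).symm ≫ (L.ap B).hom ≫ (P.genCart B).qB

theorem eval_p (B : ObGE2.{v, u} C) :
    L.eval B ≫ p B.1 rfl = qTo (pTo (P.over B)) B.A_overΓ := by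
  rw [eval, Category.assoc, Category.assoc, Cart.qB_p, ← Category.assoc (Sections.hom _),
    (L.ap B).hom_p, Category.id_comp, PiFun.genCart_qA]
  simp

/-- The diagonals are base changes of one another, hence so are the sections `ap` corresponding to
them. -/
theorem eval_stable {B B' : ObGE2.{v, u} C} (c : Cart B' B) :
    L.eval B' ≫ c.qB = c.prod2Map P ≫ L.eval B := by
  have h : (P.genMap c).SecRel (L.ap B) (L.ap B') := by
    apply L.secRel_of_piRel
    rw [lam_ap, lam_ap]
    exact P.diagSection_rel c
  have h1 : c.prod2Map P = eqToHom (P.gen_A B').symm ≫ (P.genMap c).qA ≫ eqToHom (P.gen_A B) := by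
    rw [PiFun.genMap_qA]; simp
  have h2 : (L.ap B').hom ≫ (P.genMap c).qB = (P.genMap c).qA ≫ (L.ap B).hom := h
  rw [eval, eval, Category.assoc, Category.assoc, ← Cart.comp_qB, ← PiFun.genMap_comp,
    Cart.comp_qB, ← Category.assoc (Sections.hom _), h2, h1]
  simp

/-- As `λ(o)` is the base change of the diagonal along itself, `o` is the base change of `ap` along
`λ(o)`; composed with `q`, this is the graph of `λ(o)` followed by the evaluation. -/
theorem lamInv2_eval (B : ObGE2.{v, u} C) (o : Sections B.1) :
    lamInv2 P B (L.eval B) (L.eval_p B) (L.lam B o) = o := by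
  have h : (P.sectionCart (L.lam B o)).SecRel (L.ap B) o := by
    apply L.secRel_of_piRel
    rw [lam_ap]
    exact P.sectionCart_rel _
  have h2 : o.hom ≫ (P.sectionCart (L.lam B o)).qB =
    (P.sectionCart (L.lam B o)).qA ≫ (L.ap B).hom := h
  apply Sections.ext
  rw [lamInv2_hom, ← PiFun.sectionCart_qA, eval]
  simp only [Category.assoc, eqToHom_trans_assoc, eqToHom_refl, Category.id_comp]
  rw [← Category.assoc, ← h2, Category.assoc, ← Cart.comp_qB,
    Cart.qB_of_id _ (P.sectionCart_comp_g _)]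
  exact Category.comp_id _

/-- The evaluation family of a stable family of bijections. -/
noncomputable def toAllAp2 : AllAp2 P where
  Ap := L.eval
  comp_p := L.eval_p
  stable := (stable_iff_prod2 P L.eval _).2 fun c => L.eval_stable c
  bij B := by
    -- `λinv` undoes the bijection `λ` on one side, so it is its two-sided inverse; injectivity uses
    -- the surjectivity of `λ`.
    have h : Function.RightInverse (L.lam B) (lamInv2 P B (L.eval B) (L.eval_p B)) :=
      L.lamInv2_eval B
    refine ⟨fun t t' e => ?_, h.surjective⟩
    obtain ⟨o, rfl⟩ := (L.bij B).2 t
    obtain ⟨o', rfl⟩ := (L.bij B).2 t'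
    rw [h, h] at e
    rw [e]

end NatLam

/-- The inverses of `λinv` for a family of evaluation morphisms. -/
noncomputable def AllAp2.toNatLam {P : PiFun.{v, u} C} (a : AllAp2 P) : NatLam P where
  lam B := (Equiv.ofBijective _ (a.bij B)).symm
  bij B := (Equiv.ofBijective _ (a.bij B)).symm.bijective
  natural {B' B} c o o' h := by
    -- With `o = λinv(t)`, stability of `Ap` makes `λinv(t')` a base change of `o`, and uniqueness
    -- identifies it with `o'`.
    obtain ⟨t, rfl⟩ := (Equiv.ofBijective _ (a.bij B)).surjective o
    obtain ⟨t', ht'⟩ := c.exists_piRel P t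
    have h1 := lamInv2_secRel P a.Ap a.comp_p
      ((stable_iff_prod2 P a.Ap _).1 a.stable) c ht'
    have h2 := Cart.SecRel.unique h h1
    rw [h2]
    have h3 : (Equiv.ofBijective _ (a.bij B')).symm (lamInv2 P B' (a.Ap B') (a.comp_p B') t') = t' :=
      (Equiv.ofBijective _ (a.bij B')).symm_apply_apply t'
    rw [h3, Equiv.symm_apply_apply]
    exact ht'

theorem AllAp2.lam_lamInv2 {P : PiFun.{v, u} C} (a : AllAp2 P) (B : ObGE2.{v, u} C)
    (t : Sections (P.toFun B)) :
    a.toNatLam.lam B (lamInv2 P B (a.Ap B) (a.comp_p B) t) = t :=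
  (Equiv.ofBijective _ (a.bij B)).symm_apply_apply t

/-- Stable families of bijections correspond to families of evaluation morphisms. -/
noncomputable def natLamEquiv (P : PiFun.{v, u} C) : NatLam P ≃ AllAp2 P where
  toFun L := L.toAllAp2
  invFun a := a.toNatLam
  left_inv L := by
    apply NatLam.ext
    funext B o
    have h := L.toAllAp2.lam_lamInv2 B (L.lam B o)
    rwa [show lamInv2 P B (L.toAllAp2.Ap B) (L.toAllAp2.comp_p B) (L.lam B o) = o from
      L.lamInv2_eval B o] at h
  right_inv a := by
    apply AllAp2.ext
    funext B
    -- The recovered `ap` is `λinv` at the diagonal, that is, its graph followed by `Ap` at `Π(B)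
    -- ×_Γ B`. Stability along `genCart` then moves the map to `B` in front of `Ap_B`.
    have h1 : a.toNatLam.ap B = lamInv2 P _ (a.Ap _) (a.comp_p _) (P.diagSection B) := by
      apply (a.toNatLam.bij _).1
      rw [NatLam.lam_ap, AllAp2.lam_lamInv2]
    change eqToHom _ ≫ (a.toNatLam.ap B).hom ≫ (P.genCart B).qB = _
    rw [h1, lamInv2_hom, Category.assoc, (stable_iff_prod2 P a.Ap _).1 a.stable (P.genCart B),
      ← Category.assoc (graph _), ← Category.assoc, PiFun.graph_diagSection, Category.id_comp]

/-! ### The exchange between the two forms of evaluation. -/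

/-- `p_A^*(t)` followed by the exchange has the two projections of the graph of `t`, and `lamInv2`
is the graph followed by `a`. -/
theorem lamInv1_exch (P : PiFun.{v, u} C) (B : ObGE2.{v, u} C) (a : P.prod2 B ⟶ B.1)
    (ha : a ≫ p B.1 rfl = qTo (pTo (P.over B)) B.A_overΓ)
    (ha' : IsOver (P.prod1_overA B) B.overA (exch B.A_overΓ (P.over B) ≫ a))
    (t : Sections (P.toFun B)) :
    lamInv1 P B (exch B.A_overΓ (P.over B) ≫ a) ha' t = lamInv2 P B a ha t := by
  apply Sections.ext
  rw [lamInv2_hom]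
  have hpos := (t.pull (pTo B.A_overΓ) (P.over B) (P.lt_l B t.pos)).pos
  have h : eqToHom (P.ft_prod1 B t.pos).symm ≫
      (t.pull (pTo B.A_overΓ) (P.over B) (P.lt_l B t.pos)).hom ≫ exch B.A_overΓ (P.over B) =
        graph t := by
    apply (isPullback_pull (pTo (P.over B)) B.A_overΓ).hom_ext
    · rw [Category.assoc, Category.assoc, exch_qTo, graph_qTo,
        pTo_of_ft (P.ft_prod1 B t.pos) hpos, Sections.hom_p_of_eq]
      simp
    · refine Eq.trans ?_ (graph_pTo t).symm
      refine (Category.assoc _ _ _).trans ((congrArg _ (Category.assoc _ _ _)).trans ?_)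
      refine (congrArg (fun x => _ ≫ _ ≫ x) (exch_pTo B.A_overΓ (P.over B))).trans ?_
      rw [Sections.pull_hom_qTo, qTo_self _ (P.ft_toFun B)]
      simp [Sections.toHom]
  refine Eq.trans ?_ (congrArg (· ≫ a) h)
  change _ ≫ _ ≫ _ ≫ a = _
  simp only [Category.assoc]

theorem isOver_exch_comp (P : PiFun.{v, u} C) (B : ObGE2.{v, u} C) (a : P.prod2 B ⟶ B.1) :
    IsOver (P.prod1_overA B) B.overA (exch B.A_overΓ (P.over B) ≫ a) ↔
      a ≫ p B.1 rfl = qTo (pTo (P.over B)) B.A_overΓ := by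
  have h : pTo B.overA = p B.1 rfl := pTo_of_ft rfl (by have := B.2; omega) _
  unfold IsOver
  rw [Category.assoc, h]
  constructor
  · intro h1
    have h2 := congrArg (exch (P.over B) B.A_overΓ ≫ ·) h1
    rw [← Category.assoc, exch_exch, Category.id_comp] at h2
    exact h2.trans (exch_pTo (P.over B) B.A_overΓ)
  · intro h1
    rw [h1]
    exact exch_qTo _ _

/-- The two forms of evaluation morphisms correspond under the exchange isomorphism. -/
noncomputable def exchEquiv (P : PiFun.{v, u} C) : AllAp2 P ≃ AllAp1 P where
  toFun a :=
    { Ap := fun B => exch B.A_overΓ (P.over B) ≫ a.Ap B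
      over_A := fun B => (isOver_exch_comp P B _).2 (a.comp_p B)
      stable := (stable_iff_prod1 P _ _).2 fun {B' B} c => by
        rw [Category.assoc, (stable_iff_prod2 P a.Ap _).1 a.stable c, ← Category.assoc,
          ← c.prod1Map_exch, Category.assoc]
      bij := fun B => by
        have h := a.bij B
        rwa [← funext (lamInv1_exch P B (a.Ap B) (a.comp_p B)
          ((isOver_exch_comp P B _).2 (a.comp_p B)))] at h }
  invFun a :=
    have h : ∀ B, exch B.A_overΓ (P.over B) ≫ exch (P.over B) B.A_overΓ ≫ a.Ap B = a.Ap B :=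
      fun B => by rw [← Category.assoc, exch_exch, Category.id_comp]
    have hp : ∀ B, (exch (P.over B) B.A_overΓ ≫ a.Ap B) ≫ p B.1 rfl =
        qTo (pTo (P.over B)) B.A_overΓ := fun B => by
      have := a.over_A B
      rw [← isOver_exch_comp, h]
      exact this
    { Ap := fun B => exch (P.over B) B.A_overΓ ≫ a.Ap B
      comp_p := hp
      stable := (stable_iff_prod2 P _ _).2 fun {B' B} c => by
        have h1 := (stable_iff_prod1 P a.Ap _).1 a.stable c
        rw [Category.assoc, h1, ← Category.assoc, ← Category.assoc]
        exact congrArg (· ≫ a.Ap B) (fprodMap_exch c.g (P.over B) B.A_overΓ (P.over B') B'.A_overΓ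
          (c.eq_Pi P) c.eq_A).symm
      bij := fun B => by
        have h1 := a.bij B
        have h2 : lamInv1 P B (a.Ap B) (a.over_A B) =
            lamInv2 P B (exch (P.over B) B.A_overΓ ≫ a.Ap B) (hp B) := by
          funext t
          rw [← lamInv1_exch P B _ _ ((isOver_exch_comp P B _).2 (hp B))]
          congr 1
          exact (h B).symm
        rwa [h2] at h1 }
  left_inv a := by
    apply AllAp2.ext
    funext B
    change exch _ _ ≫ exch _ _ ≫ _ = _
    rw [← Category.assoc]
    exact (congrArg (· ≫ a.Ap B) (exch_exch _ _)).trans (Category.id_comp _)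
  right_inv a := by
    apply AllAp1.ext
    funext B
    change exch _ _ ≫ exch _ _ ≫ _ = _
    rw [← Category.assoc, exch_exch, Category.id_comp]

/-! ### Morphisms of presheaves -/

/-- The index `Γ` carries no information beyond `X ∈ Ob_2(Γ)`, because `Γ = ft²(X)`. In the
surjectivity part, `PiFun.pos` supplies the length `l(Γ) + 1` required of the values. -/
theorem bijective_phi : Function.Bijective (phi (C := C)) := by
  constructor
  · intro Pi Pi' h
    apply NatTrans.ext
    funext Γ
    apply ConcreteCategory.hom_ext
    intro X
    have hX : 2 ≤ l (ObN.obj (Γ := Γ.unop) X) := by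
      have := ObN.l_obj (Γ := Γ.unop) X; omega
    apply ObN.ext
    refine (app_obj_eq Pi X hX).trans (Eq.trans ?_ (app_obj_eq Pi' X hX).symm)
    exact congrFun (congrArg PiFun.toFun h) ⟨_, hX⟩
  · intro P
    have key : ∀ {Γ : C} (X : ObN.{v, u} 2 Γ) (h : 2 ≤ l X.obj), ft (P.toFun ⟨X.obj, h⟩) = Γ := by
      intro Γ X h
      exact (P.ft_toFun _).trans X.ft_obj
    have hX : ∀ {Γ : C} (X : ObN.{v, u} 2 Γ), 2 ≤ l X.obj := by
      intro Γ X
      have := X.l_obj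
      omega
    have hl : ∀ {Γ : C} (X : ObN.{v, u} 2 Γ), l (P.toFun ⟨X.obj, hX X⟩) = l Γ + 1 := by
      intro Γ X
      have h1 := P.pos ⟨X.obj, hX X⟩
      have h2 := l_ft _ h1
      rw [key X] at h2
      omega
    refine ⟨⟨fun Γ => TypeCat.ofHom fun X : ObN.{v, u} 2 Γ.unop =>
      (⟨P.toFun ⟨X.obj, hX X⟩, hl X, key X _⟩ : ObN.{v, u} 1 Γ.unop), ?_⟩, ?_⟩
    · intro Γ Γ' f
      apply ConcreteCategory.hom_ext
      intro X
      apply ObN.ext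
      obtain ⟨Γ⟩ := Γ
      obtain ⟨X, h1, h2⟩ : ObN.{v, u} 2 Γ := X
      -- Replacing `Γ` by `ft²(X)` turns naturality into the stability hypothesis on `P`.
      have h2' : ft (ft X) = Γ := h2
      subst h2'
      exact (P.pull_toFun ⟨X, _⟩ f.unop).symm
    · rfl

theorem cod_app_eq {Pi : obPresheaf.{v, u} C 2 ⟶ obPresheaf.{v, u} C 1}
    {lam : tobPresheaf.{v, u} C 2 ⟶ tobPresheaf.{v, u} C 1}
    (h : lam ≫ bd C 1 = bd C 2 ≫ Pi) {Γ : C} (o : TObN.{v, u} 2 Γ) :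
    (lam.app (op Γ) o : TObN.{v, u} 1 Γ).cod = Pi.app (op Γ) o.cod :=
  ConcreteCategory.congr_hom (NatTrans.congr_app h (op Γ))
    (show ToType ((tobPresheaf.{v, u} C 2).obj (op Γ)) from o)

/-- The map induced by `λ` on the fibres of `∂`. -/
def fibApp {Pi : obPresheaf.{v, u} C 2 ⟶ obPresheaf.{v, u} C 1}
    {lam : tobPresheaf.{v, u} C 2 ⟶ tobPresheaf.{v, u} C 1}
    (h : lam ≫ bd C 1 = bd C 2 ≫ Pi) {Γ : C} (B : ObN.{v, u} 2 Γ) (o : Fib B) :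
    Fib (Pi.app (op Γ) B : ObN.{v, u} 1 Γ) :=
  ⟨lam.app (op Γ) o.1, (cod_app_eq h o.1).trans
    (congrArg (fun X : ObN.{v, u} 2 Γ => (Pi.app (op Γ) X : ObN.{v, u} 1 Γ)) o.2)⟩

/-- Pullbacks of presheaves are objectwise, and a commutative square of sets is a pullback iff the
induced maps between the fibres of its vertical sides are bijective. -/
theorem isPullback_bd_iff (Pi : obPresheaf.{v, u} C 2 ⟶ obPresheaf.{v, u} C 1)
    (lam : tobPresheaf.{v, u} C 2 ⟶ tobPresheaf.{v, u} C 1)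
    (h : lam ≫ bd C 1 = bd C 2 ≫ Pi) :
    IsPullback lam (bd C 2) (bd C 1) Pi ↔ ∀ (Γ : C) (B : ObN.{v, u} 2 Γ),
      Function.Bijective (fibApp h B) := by
  constructor
  · intro hp Γ B
    have h1 := (Limits.Types.isPullback_iff _ _ _ _).1 (hp.app (op Γ))
    constructor
    · rintro ⟨o, ho⟩ ⟨o', ho'⟩ e
      apply Subtype.ext
      exact h1.2.1 _ _ ⟨congrArg Subtype.val e, ho.trans ho'.symm⟩
    · rintro ⟨t, ht⟩
      obtain ⟨o, ho, ho'⟩ := h1.2.2 t B ht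
      exact ⟨⟨o, ho'⟩, Subtype.ext ho⟩
  · intro hb
    apply IsPullback.of_forall_isPullback_app
    intro Γ
    rw [Limits.Types.isPullback_iff]
    refine ⟨NatTrans.congr_app h Γ, ?_, ?_⟩
    · rintro (o : TObN.{v, u} 2 Γ.unop) (o' : TObN.{v, u} 2 Γ.unop) ⟨e, e'⟩
      exact congrArg Subtype.val ((hb Γ.unop o'.cod).1 (a₁ := ⟨o, e'⟩) (a₂ := ⟨o', rfl⟩)
        (Subtype.ext e))
    · intro t B ht
      obtain ⟨o, ho⟩ := (hb Γ.unop B).2 ⟨t, ht⟩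
      exact ⟨o.1, congrArg Subtype.val ho, o.2⟩

/-- The morphisms `λ` of presheaves with a pullback square are the natural double families of
bijections of fibres. -/
noncomputable def lamEquiv (Pi : obPresheaf.{v, u} C 2 ⟶ obPresheaf.{v, u} C 1) :
    AllLam1 Pi ≃ AllLam2 Pi where
  toFun L :=
    { lam := fun Γ B o => fibApp L.2.w B o
      bij := (isPullback_bd_iff Pi L.1 L.2.w).1 L.2
      natural := fun f B o => (ConcreteCategory.congr_hom (L.1.naturality f.op)
        (show ToType ((tobPresheaf.{v, u} C 2).obj (op _)) from o.1)).symm }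
  invFun L :=
    -- The value at `o` does not depend on which name is used for the fibre containing `o`.
    have h : ∀ {Γ : C} (B B' : ObN.{v, u} 2 Γ) (o : TObN.{v, u} 2 Γ) (h : o.cod = B)
        (h' : o.cod = B'), (L.lam Γ B ⟨o, h⟩).1 = (L.lam Γ B' ⟨o, h'⟩).1 := by
      intro Γ B B' o h h'; subst h; subst h'; rfl
    let lam : tobPresheaf.{v, u} C 2 ⟶ tobPresheaf.{v, u} C 1 :=
      { app := fun Γ => TypeCat.ofHom fun o : TObN.{v, u} 2 Γ.unop =>
          (L.lam Γ.unop o.cod ⟨o, rfl⟩).1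
        naturality := by
          intro Γ Γ' f
          apply ConcreteCategory.hom_ext
          intro o
          exact (L.natural f.unop (TObN.cod (Γ := Γ.unop) o) ⟨o, rfl⟩).symm }
    have hw : lam ≫ bd C 1 = bd C 2 ≫ Pi := by
      apply NatTrans.ext
      funext Γ
      apply ConcreteCategory.hom_ext
      intro o
      exact (L.lam Γ.unop (TObN.cod (Γ := Γ.unop) o) ⟨o, rfl⟩).2
    ⟨lam, (isPullback_bd_iff Pi lam hw).2 fun Γ B => by
      have hb := L.bij Γ B
      have e : L.lam Γ B = fibApp hw B := funext fun o => Subtype.ext (h B o.1.cod o.1 o.2 rfl)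
      rwa [e] at hb⟩
  left_inv L := rfl
  right_inv L := by
    apply AllLam2.ext
    funext Γ B o
    obtain ⟨o, rfl⟩ := o
    rfl

/-! ### Double families and families indexed by `Ob_{≥ 2}` -/

/-- The section underlying an element of a fibre of `∂`. -/
def Fib.section {n : ℕ} {Γ : C} {B : ObN.{v, u} n Γ} (o : Fib B) : Sections B.obj :=
  o.2 ▸ o.1.sec

theorem Fib.section_fibMk {n : ℕ} (hn : 0 < n) {Γ : C} (B : ObN.{v, u} n Γ)
    (t : Sections B.obj) : (fibMk hn B t).section = t := rfl

theorem Fib.fibMk_section {n : ℕ} (hn : 0 < n) {Γ : C} {B : ObN.{v, u} n Γ} (o : Fib B) :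
    fibMk hn B o.section = o := by
  obtain ⟨o, rfl⟩ := o
  rfl

/-- Elements of the fibre of `∂` are sections. -/
def fibEquiv {n : ℕ} (hn : 0 < n) {Γ : C} (B : ObN.{v, u} n Γ) : Fib B ≃ Sections B.obj where
  toFun := Fib.section
  invFun := fibMk hn B
  left_inv := Fib.fibMk_section hn
  right_inv := Fib.section_fibMk hn B

/-- A section of `p` at a pulled back object is determined by its composite with `q`. This
translates equality in the presheaf `Õb_n` into the relations `SecRel` and `PiRel`. -/
theorem TObN.pull_eq_iff {n : ℕ} {Γ' Γ : C} (g : Γ' ⟶ Γ) (o : TObN.{v, u} n Γ)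
    (o' : TObN.{v, u} n Γ') (e : o'.cod.obj = CSystem.pull g o.cod.over)
    (e' : ft o'.cod.obj = CSystem.pull g (over_ft o.cod.over o.above)) :
    o.pull g = o' ↔ o'.sec.hom ≫ eqToHom e ≫ qTo g o.cod.over =
      eqToHom e' ≫ qTo g (over_ft o.cod.over o.above) ≫ o.sec.hom := by
  obtain ⟨X, t, ht⟩ := o'
  obtain rfl : X = o.cod.pull g := ObN.ext e
  have h := o.sec.pull_hom_qTo g o.cod.over o.above
  constructor
  · intro h1
    obtain rfl : (o.pull g).sec = t := by
      have h2 := (TObN.mk.inj h1).2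
      exact eq_of_heq h2
    exact (congrArg ((o.sec.pull g o.cod.over o.above).hom ≫ ·)
      (Category.id_comp (qTo g o.cod.over))).trans h
  · intro h1
    have h2 : t = o.sec.pull g o.cod.over o.above := by
      apply Sections.ext_qTo o.above
      exact (congrArg (t.hom ≫ ·) (Category.id_comp (qTo g o.cod.over))).symm.trans
        (h1.trans h.symm)
    subst h2
    rfl

theorem Cart.secRel_iff {B' B : ObGE2.{v, u} C} (c : Cart B' B) (o : Sections B.1)
    (o' : Sections B'.1) : c.SecRel o o' ↔
      (fibMk two_pos B.toObN o).1.pull c.g = (fibMk two_pos B'.toObN o').1 := by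
  unfold Cart.SecRel Cart.qA Cart.qB
  rw [Category.assoc]
  exact (TObN.pull_eq_iff c.g (fibMk two_pos B.toObN o).1 (fibMk two_pos B'.toObN o').1 c.eq c.eq_A).symm

theorem eqToHom_comp_eq_iff {D E F F' M Y Z : C} (x : D ⟶ Y) (w : Y ⟶ Z) (k : E ⟶ F) (y : F' ⟶ Z)
    (e : E = D) (e' : F = F') (h : D = M) (h' : M = E) :
    (eqToHom e ≫ x) ≫ w = k ≫ eqToHom e' ≫ y ↔
      x ≫ w = eqToHom h ≫ (eqToHom h' ≫ k ≫ eqToHom e') ≫ y := by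
  subst e e' h
  simp

/-- The father of `Π(B)` is `Γ` itself, so `q(g, ft(Π(B)))` is `g` up to casts; the rest compares
the casts in `toHom` with those of the presheaf. -/
theorem Cart.piRel_iff {Pi : obPresheaf.{v, u} C 2 ⟶ obPresheaf.{v, u} C 1}
    {B' B : ObGE2.{v, u} C} (c : Cart B' B)
    (t : Fib (Pi.app (op B.Γ) B.toObN : ObN.{v, u} 1 B.Γ))
    (t' : Fib (Pi.app (op B'.Γ) B'.toObN : ObN.{v, u} 1 B'.Γ)) :
    c.PiRel (phi Pi) t.section t'.section ↔ t.1.pull c.g = t'.1 := by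
  obtain ⟨t, rfl⟩ := (fibEquiv one_pos _).symm.surjective t
  obtain ⟨t', rfl⟩ := (fibEquiv one_pos _).symm.surjective t'
  have e : ft ((phi Pi).toFun B') =
      CSystem.pull c.g (over_ft ((phi Pi).over B) ((phi Pi).lt_l B (phi_pos Pi B))) := by
    rw [pull_self _ ((phi Pi).ft_toFun B), (phi Pi).ft_toFun]
  refine Iff.trans ?_ (TObN.pull_eq_iff c.g (fibMk one_pos _ t).1 (fibMk one_pos _ t').1
    (c.eq_Pi (phi Pi)) e).symm
  change (eqToHom _ ≫ t'.hom) ≫ c.qPi (phi Pi) = c.g ≫ eqToHom _ ≫ t.hom ↔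
    t'.hom ≫ c.qPi (phi Pi) = eqToHom e ≫ qTo c.g (over_ft ((phi Pi).over B)
      ((phi Pi).lt_l B (phi_pos Pi B))) ≫ t.hom
  rw [qTo_self c.g ((phi Pi).ft_toFun B)]
  exact eqToHom_comp_eq_iff _ _ _ _ _ _ _ _

theorem two_le_l_obj {Γ : C} (X : ObN.{v, u} 2 Γ) : 2 ≤ l X.obj := by
  have := X.l_obj
  omega

/-- To prove a property of all `X ∈ Ob_2(Γ)` it suffices to consider objects of length `≥ 2`. -/
theorem ObN.rec_toObN {motive : ∀ Γ : C, ObN.{v, u} 2 Γ → Prop}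
    (h : ∀ B : ObGE2.{v, u} C, motive B.Γ B.toObN) {Γ : C} (X : ObN.{v, u} 2 Γ) : motive Γ X := by
  have hX := two_le_l_obj X
  obtain ⟨X, h1, h2⟩ := X
  have h2' : ft (ft X) = Γ := h2
  subst h2'
  exact h ⟨X, hX⟩

theorem AllLam2.lam_congr {Pi : obPresheaf.{v, u} C 2 ⟶ obPresheaf.{v, u} C 1} (L : AllLam2 Pi)
    {Γ : C} {B B' : ObN.{v, u} 2 Γ} (o : Fib B) (o' : Fib B') (h : o.1 = o'.1) :
    (L.lam Γ B o).1 = (L.lam Γ B' o').1 := by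
  obtain ⟨o, rfl⟩ := o
  obtain ⟨o', rfl⟩ := o'
  obtain rfl : o = o' := h
  rfl

/-- The restriction of a double family to `Γ = ft²(B)`. -/
def AllLam2.toNatLam {Pi : obPresheaf.{v, u} C 2 ⟶ obPresheaf.{v, u} C 1} (L : AllLam2 Pi) :
    NatLam (phi Pi) where
  lam B o := (L.lam B.Γ B.toObN (fibMk two_pos B.toObN o)).section
  bij B := ((fibEquiv one_pos _).bijective.comp (L.bij B.Γ B.toObN)).comp
    (fibEquiv two_pos B.toObN).symm.bijective
  natural {B' B} c o o' h := by
    rw [Cart.piRel_iff]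
    rw [Cart.secRel_iff] at h
    exact (L.natural c.g B.toObN (fibMk two_pos B.toObN o)).trans (L.lam_congr _ _ h)

/-- The double family with a given restriction. -/
def NatLam.lam₂ {Pi : obPresheaf.{v, u} C 2 ⟶ obPresheaf.{v, u} C 1} (L : NatLam (phi Pi))
    (Γ : C) (X : ObN.{v, u} 2 Γ) (o : Fib X) : Fib (Pi.app (op Γ) X : ObN.{v, u} 1 Γ) :=
  fibMk one_pos _ (cast (congrArg Sections (app_obj_eq Pi X (two_le_l_obj X)).symm)
    (L.lam ⟨X.obj, two_le_l_obj X⟩ o.section))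

/-- The pulled back object is a variable `Y` with an equation, so that `Γ'` as well as `Γ` can be
replaced by `ft²` of its object. After both replacements `f` is literally the base map of a `Cart`.
-/
theorem NatLam.lam₂_natural {Pi : obPresheaf.{v, u} C 2 ⟶ obPresheaf.{v, u} C 1}
    (L : NatLam (phi Pi)) {Γ : C} (X : ObN.{v, u} 2 Γ) : ∀ {Γ' : C} (Y : ObN.{v, u} 2 Γ')
      (f : Γ' ⟶ Γ) (_ : Y = X.pull f) (o : Fib X) (o' : Fib Y), o.1.pull f = o'.1 →
      (fibPull f (L.lam₂ Γ X o)).1 = (L.lam₂ Γ' Y o').1 := by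
  refine ObN.rec_toObN (motive := fun Γ X => ∀ {Γ' : C} (Y : ObN.{v, u} 2 Γ')
      (f : Γ' ⟶ Γ) (_ : Y = X.pull f) (o : Fib X) (o' : Fib Y), o.1.pull f = o'.1 →
      (fibPull f (L.lam₂ Γ X o)).1 = (L.lam₂ Γ' Y o').1) ?_ X
  intro B Γ' Y
  refine ObN.rec_toObN (motive := fun Γ' Y => ∀
      (f : Γ' ⟶ B.Γ) (_ : Y = B.toObN.pull f) (o : Fib B.toObN) (o' : Fib Y), o.1.pull f = o'.1 →
      (fibPull f (L.lam₂ B.Γ B.toObN o)).1 = (L.lam₂ Γ' Y o').1) ?_ Y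
  intro B' f e o o' h
  obtain ⟨o, rfl⟩ := (fibEquiv two_pos _).symm.surjective o
  obtain ⟨o', rfl⟩ := (fibEquiv two_pos _).symm.surjective o'
  have h1 := L.natural ⟨f, congrArg ObN.obj e⟩ o o' ((Cart.secRel_iff _ _ _).2 h)
  exact (Cart.piRel_iff _ (fibMk one_pos _ _) (fibMk one_pos _ _)).1 h1

/-- The double family with a given restriction to `Γ = ft²(B)`. -/
def NatLam.toAllLam2 {Pi : obPresheaf.{v, u} C 2 ⟶ obPresheaf.{v, u} C 1}
    (L : NatLam (phi Pi)) : AllLam2 Pi where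
  lam := L.lam₂
  bij _ X := ObN.rec_toObN (motive := fun Γ X => Function.Bijective (L.lam₂ Γ X))
    (fun B => ((fibEquiv one_pos _).symm.bijective.comp (L.bij B)).comp
      (fibEquiv two_pos B.toObN).bijective) X
  natural f X o := L.lam₂_natural X _ f rfl o _ rfl

/-- Double families are determined by their restrictions to `Γ = ft²(B)`. -/
def allLam2Equiv (Pi : obPresheaf.{v, u} C 2 ⟶ obPresheaf.{v, u} C 1) :
    AllLam2 Pi ≃ NatLam (phi Pi) where
  toFun L := L.toNatLam
  invFun L := L.toAllLam2
  left_inv L := by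
    apply AllLam2.ext
    funext Γ X
    refine ObN.rec_toObN (motive := fun Γ X => L.toNatLam.lam₂ Γ X = L.lam Γ X) ?_ X
    intro B
    funext o
    obtain ⟨o, rfl⟩ := (fibEquiv two_pos _).symm.surjective o
    exact Fib.fibMk_section one_pos _
  -- At `B.toObN` the cast in `lam₂` is between definitionally equal types.
  right_inv L := rfl

/-! ### Comparison with the operation `s` of the C-system, and packaging of structures. -/

theorem arrow_mk_eq {D D' Y Y' : C} (e : D = D') (e' : Y = Y') {s : D ⟶ Y} {s' : D' ⟶ Y'}
    (h : s ≫ eqToHom e' = eqToHom e ≫ s') : Arrow.mk s = Arrow.mk s' := by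
  subst e e'
  rw [eqToHom_refl, eqToHom_refl, Category.comp_id, Category.id_comp] at h
  rw [h]

theorem pullPair_of_ft {Γ' Γ X : C} (f : Γ' ⟶ Γ) (e : ft X = Γ) (h0 : 0 < l X)
    (h : ObOver X Γ) : (⟨pull f h, qTo f h⟩ : Σ Y : C, Y ⟶ X) = ⟨pb f X e h0, q f X e h0⟩ := by
  subst e
  rw [pull_eq f h (n := 1) (by rw [l_ft X h0]; omega) rfl]
  change (⟨pb (f ≫ 𝟙 _) X rfl h0, q (f ≫ 𝟙 _) X rfl h0⟩ : Σ Y : C, Y ⟶ X) = _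
  rw [Category.comp_id]

/-- Both morphisms are sections of the projection of `p_{Π(B)}^*(Π(B))` whose composite with `q` is
the identity, which determines them. The equality is one of arrows because one side uses `pull` and
the other `pb`. -/
theorem arrow_diagSection (Pi : obPresheaf.{v, u} C 2 ⟶ obPresheaf.{v, u} C 1)
    (B : ObGE2.{v, u} C) :
    Arrow.mk ((phi Pi).diagSection B).hom = Arrow.mk (diag Pi B) := by
  have hpos : 0 < l ((phi Pi).toFun B) := phi_pos Pi B
  have e1 := pullPair_of_ft (pTo ((phi Pi).over B)) ((phi Pi).ft_toFun B) hpos ((phi Pi).over B)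
  have e2 : ∀ {Δ : C} (e : ft ((phi Pi).toFun B) = Δ) (f : (phi Pi).toFun B ⟶ Δ), f = p _ e →
      (⟨pb f ((phi Pi).toFun B) e hpos, q f ((phi Pi).toFun B) e hpos⟩ : Σ Y : C, Y ⟶ (phi Pi).toFun B) =
        ⟨pb (𝟙 _ ≫ p ((phi Pi).toFun B) rfl) _ rfl hpos, q (𝟙 _ ≫ p ((phi Pi).toFun B) rfl) _ rfl hpos⟩ := by
    intro Δ e f hf
    subst e hf
    rw [Category.id_comp]
  have e3 := e1.trans (e2 _ _ (pTo_of_ft ((phi Pi).ft_toFun B) hpos _))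
  have h1 := eq_eqToHom_of_sigma e3
  have e4 : (phi Pi).toFun ((phi Pi).gen B) = pb (𝟙 _ ≫ p ((phi Pi).toFun B) rfl) _ rfl hpos :=
    ((phi Pi).pull_toFun B _).symm.trans (congrArg Sigma.fst e3)
  have h2 : ((phi Pi).genCart B).qPi (phi Pi) = eqToHom e4 ≫ q (𝟙 _ ≫ p ((phi Pi).toFun B) rfl) _ rfl hpos := by
    rw [PiFun.genCart, Cart.ofHom_qPi, h1, eqToHom_trans_assoc]
  have e5 : ft ((phi Pi).toFun ((phi Pi).gen B)) = (phi Pi).toFun B := ((phi Pi).ft_toFun _).trans ((phi Pi).gen_Γ B)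
  apply arrow_mk_eq e5 e4
  apply (isPullback_pb (𝟙 _ ≫ p ((phi Pi).toFun B) rfl) _ rfl hpos).hom_ext
  · have h3 := (phi Pi).diagSection_qPi B
    rw [Sections.toHom, Category.assoc, h2] at h3
    have h4 : diag Pi B ≫ q (𝟙 _ ≫ p ((phi Pi).toFun B) rfl) _ rfl hpos = 𝟙 _ := s_q _ _
    rw [Category.assoc, Category.assoc, h4, ← cancel_epi (eqToHom ((phi Pi).ft_toFun ((phi Pi).gen B)).symm), h3]
    simp
  · have h4 : diag Pi B ≫ p _ (ft_pb (𝟙 _ ≫ p ((phi Pi).toFun B) rfl) _ rfl hpos) = 𝟙 _ := s_p _ _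
    rw [Category.assoc, Category.assoc, h4, eqToHom_p, Sections.hom_p_of_eq]
    simp

/-- Once `Γ` is replaced by `ft²(X)`, the restricted family is the double family by definition. It
is needed at `Π(B) ×_Γ B`, whose base is `Π(B)` only propositionally. -/
theorem AllLam2.arrow_lam {Pi : obPresheaf.{v, u} C 2 ⟶ obPresheaf.{v, u} C 1} (L : AllLam2 Pi)
    {Γ : C} (X : ObN.{v, u} 2 Γ) : ∀ o : Sections X.obj,
      Arrow.mk (L.lam Γ X (fibMk two_pos X o)).1.sec.hom =
        Arrow.mk (L.toNatLam.lam ⟨X.obj, two_le_l_obj X⟩ o).hom := by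
  refine ObN.rec_toObN (motive := fun Γ X => ∀ o : Sections X.obj,
      Arrow.mk (L.lam Γ X (fibMk two_pos X o)).1.sec.hom =
        Arrow.mk (L.toNatLam.lam ⟨X.obj, two_le_l_obj X⟩ o).hom) ?_ X
  intro B o
  have h : ∀ {n : ℕ} {Γ : C} {Y : ObN.{v, u} n Γ} (t : Fib Y),
      Arrow.mk t.1.sec.hom = Arrow.mk t.section.hom := by
    rintro n Γ Y ⟨t, rfl⟩
    rfl
  exact h _

/-- `(Π, λ)`-structures are pairs of `Π` and a compatible `λ`. -/
def piLambdaEquiv : PiLambda.{v, u} C ≃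
    Σ Pi : obPresheaf.{v, u} C 2 ⟶ obPresheaf.{v, u} C 1, AllLam1 Pi where
  toFun x := ⟨x.Pi, x.lam, x.isPullback⟩
  invFun y := ⟨y.1, y.2.1, y.2.2⟩
  left_inv _ := rfl
  right_inv _ := rfl

/-- Cartmell–Streicher structures are pairs of `Π` and a compatible family `Ap`. -/
def cartmellStreicherEquiv : (Σ P : PiFun.{v, u} C, AllAp1 P) ≃ CartmellStreicher.{v, u} C where
  toFun y := ⟨y.1, y.2⟩
  invFun x := ⟨x.Pi, x.Ap⟩
  left_inv _ := rfl
  right_inv _ := rfl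

end CSystem

/-! ### Assembly of the bijections. -/

theorem mainTheorem1 (C : Type u) [CSystem.{v} C] :
    Function.Bijective (CSystem.phi (C := C)) ∧
    ∃ (e₁ : ∀ Pi : CSystem.obPresheaf C 2 ⟶ CSystem.obPresheaf C 1,
          CSystem.AllLam1 Pi ≃ CSystem.AllLam2 Pi)
      (e₂ : ∀ Pi : CSystem.obPresheaf C 2 ⟶ CSystem.obPresheaf C 1,
          CSystem.AllLam2 Pi ≃ CSystem.AllAp2 (CSystem.phi Pi))
      (e₃ : ∀ P : CSystem.PiFun C, CSystem.AllAp2 P ≃ CSystem.AllAp1 P)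
      (E : CSystem.PiLambda C ≃ CSystem.CartmellStreicher C),
      (∀ Pi (lam : CSystem.AllLam1 Pi) (Γ : C) (B : CSystem.ObN 2 Γ) (o : CSystem.Fib B),
        ((e₁ Pi lam).lam Γ B o).1 = lam.1.app (Opposite.op Γ) o.1) ∧
      (∀ Pi (lam : CSystem.AllLam2 Pi) (B : CSystem.ObGE2 C),
        ∃ ap : CSystem.Sections (B.toObN.pull (CSystem.pPi Pi B)).obj,
          Arrow.mk (lam.lam _ _ (CSystem.fibMk two_pos _ ap)).1.sec.hom =
            Arrow.mk (CSystem.diag Pi B) ∧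
          Arrow.mk ((e₂ Pi lam).Ap B) =
            Arrow.mk (ap.hom ≫ CSystem.qTo (CSystem.pPi Pi B) B.overΓ)) ∧
      (∀ Pi (Ap : CSystem.AllAp2 (CSystem.phi Pi)) (B : CSystem.ObGE2 C)
        (t : CSystem.Sections ((CSystem.phi Pi).toFun B)),
        ((e₂ Pi).symm Ap).lam B.Γ B.toObN
            (CSystem.fibMk two_pos B.toObN (CSystem.lamInv2 _ B (Ap.Ap B) (Ap.comp_p B) t)) =
          CSystem.fibMk one_pos (Pi.app (Opposite.op B.Γ) B.toObN) t) ∧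
      (∀ P (Ap : CSystem.AllAp2 P) (B : CSystem.ObGE2 C),
        (e₃ P Ap).Ap B = CSystem.exch B.A_overΓ (P.over B) ≫ Ap.Ap B) ∧
      (∀ x : CSystem.PiLambda C,
        E x = ⟨CSystem.phi x.Pi, e₃ _ (e₂ _ (e₁ _ ⟨x.lam, x.isPullback⟩))⟩) := by
  refine ⟨CSystem.bijective_phi, CSystem.lamEquiv,
    fun Pi => (CSystem.allLam2Equiv Pi).trans (CSystem.natLamEquiv (CSystem.phi Pi)),
    CSystem.exchEquiv,
    -- The total bijection is `Φ` on the base and the composite of the three bijections on each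
    -- fibre, so the last formula holds by definition.
    (CSystem.piLambdaEquiv.trans (Equiv.sigmaCongr (Equiv.ofBijective _ CSystem.bijective_phi)
      fun Pi => (CSystem.lamEquiv Pi).trans (((CSystem.allLam2Equiv Pi).trans
        (CSystem.natLamEquiv (CSystem.phi Pi))).trans (CSystem.exchEquiv (CSystem.phi Pi))))).trans
      CSystem.cartmellStreicherEquiv, ?_, ?_, ?_, ?_, ?_⟩
  · intro Pi lam Γ B o
    rfl
  · intro Pi lam B
    -- The witness is the section that the restricted family sends to the diagonal.
    refine ⟨lam.toNatLam.ap B, ?_, ?_⟩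
    · refine (lam.arrow_lam (B.toObN.pull (CSystem.pPi Pi B)) _).trans ?_
      refine Eq.trans ?_ (CSystem.arrow_diagSection Pi B)
      exact congrArg (fun t : CSystem.Sections _ => Arrow.mk t.hom) (lam.toNatLam.lam_ap B)
    · refine CSystem.arrow_mk_eq ((CSystem.phi Pi).gen_A B).symm rfl ?_
      refine (Category.comp_id _).trans ?_
      refine congrArg (fun w => eqToHom _ ≫ (lam.toNatLam.ap B).hom ≫ w) ?_
      exact CSystem.Cart.ofHom_qB _ _
  · intro Pi Ap B t
    exact congrArg (CSystem.fibMk one_pos _) (Ap.lam_lamInv2 B t)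
  · intro P Ap B
    rfl
  · intro x
    rfl
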